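/- Write $\mathbb{F}_2^n$ for the $n$-dimensional vector space over the field with two elements. For $F:\mathbb{F}_2^n\to\mathbb{C}$ put $F_y(x)=F(x+y)\overline{F(x)}$, let $F_{y_1,\dots,y_d}=(F_{y_1,\dots,y_{d-1}})_{y_d}$ be the iterated derivatives, and for $d\ge 1$ let $$\|F\|_{U^d}=\Bigl(\mathbb{E}_{x,y_1,\dots,y_d\in\mathbb{F}_2^n}\,F_{y_1,\dots,y_d}(x)\Bigr)^{1/2^d}$$ be the $d$-th Gowers norm (the average is a nonnegative real number). **Theorem.** The following two statements are equivalent. 1. (Polynomial Freiman–Ruzsa conjecture.) There is an absolute constant $C>0$ such that for every $n\ge 0$, every real $K$ and every nonempty $S\subseteq\mathbb{F}_2^n$ with $|S+S|\le K|S|$ there is a subset $S'\subseteq S$ with $|S'|\ge C^{-1}K^{-C}|S|$ and $|\mathrm{Span}(S')|\le C K^{C}|S|$, where $\mathrm{Span}$ is the linear span over $\mathbb{F}_2$. 2. (Polynomial inverse Gowers conjecture for $U^3$.) There is an absolute constant $C>0$ such that for every $n\ge 0$, every $\varepsilon>0$ and every $f:\mathbb{F}_2^n\to\mathbb{F}_2$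 with $\|(-1)^f\|_{U^3}\ge\varepsilon$ there is a polynomial $p$ over $\mathbb{F}_2$ in $n$ variables, of degree at most $2$, with $\Pr_{x\in\mathbb{F}_2^n}[f(x)=p(x)]\ge\tfrac12+C^{-1}\varepsilon^{C}$. -/

import Mathlib

open scoped BigOperators Pointwise

/-- The vector space `𝔽₂ⁿ`. -/
abbrev F2 (n : ℕ) : Type := Fin n → ZMod 2

/-- The multiplicative derivative `F_y(x) = F(x + y) * conj (F x)`. -/
noncomputable def mulDeriv {n : ℕ} (F : F2 n → ℂ) (y : F2 n) : F2 n → ℂ :=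
  fun x => F (x + y) * (starRingEnd ℂ) (F x)

/-- The iterated derivative `F_{y₁,…,y_d} = (F_{y₁,…,y_{d-1}})_{y_d}`. -/
noncomputable def iterMulDeriv {n : ℕ} (F : F2 n → ℂ) : (d : ℕ) → (Fin d → F2 n) → F2 n → ℂ
  | 0, _ => F
  | d + 1, y => mulDeriv (iterMulDeriv F d (Fin.init y)) (y (Fin.last d))

/-- The average `𝔼_{x,y₁,…,y_d} F_{y₁,…,y_d}(x)`. -/
noncomputable def gowersAverage {n : ℕ} (d : ℕ) (F : F2 n → ℂ) : ℂ :=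
  𝔼 y : Fin d → F2 n, 𝔼 x : F2 n, iterMulDeriv F d y x

/-- The `d`-th Gowers norm, for `d ≥ 1`. The average is then a nonnegative real number
(see `gowersAverage_nonneg`), so that taking its real part changes nothing. -/
noncomputable def gowersNorm {n : ℕ} (d : ℕ) (F : F2 n → ℂ) : ℝ :=
  (gowersAverage d F).re ^ ((1 : ℝ) / 2 ^ d)

open scoped ComplexOrder in
/-- For `d ≥ 1` the average in the Gowers norm is real and nonnegative. -/
theorem gowersAverage_nonneg {n : ℕ} (d : ℕ) (F : F2 n → ℂ) :
    0 ≤ gowersAverage (d + 1) F := by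
  have key : ∀ G : F2 n → ℂ, 0 ≤ ∑ y : F2 n, ∑ x : F2 n, mulDeriv G y x := by
    intro G
    have h : ∑ y : F2 n, ∑ x : F2 n, mulDeriv G y x
        = (∑ x, G x) * (starRingEnd ℂ) (∑ x, G x) := by
      rw [Finset.sum_comm, map_sum, Finset.mul_sum]
      refine Finset.sum_congr rfl fun x _ => ?_
      rw [Finset.sum_mul]
      exact Fintype.sum_equiv (Equiv.addLeft x) _ _ fun y => rfl
    rw [h]
    exact mul_star_self_nonneg (∑ x, G x)
  have hs : 0 ≤ ∑ y : Fin (d + 1) → F2 n, ∑ x : F2 n, iterMulDeriv F (d + 1) y x := by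
    rw [← (Fin.snocEquiv fun _ : Fin (d + 1) => F2 n).sum_comp, Fintype.sum_prod_type,
      Finset.sum_comm]
    refine Finset.sum_nonneg fun z _ => ?_
    simpa [iterMulDeriv, Fin.snocEquiv] using key (iterMulDeriv F d z)
  unfold gowersAverage
  simp only [Fintype.expect_eq_sum_div_card, ← Finset.sum_div]
  positivity

/-- The complex-valued function `(-1)^f` attached to `f : 𝔽₂ⁿ → 𝔽₂`. -/
noncomputable def signFun {n : ℕ} (f : F2 n → ZMod 2) : F2 n → ℂ :=
  fun x => (-1) ^ (f x).val

/-- `Pr_x[f(x) = g(x)]` for a uniformly random `x ∈ 𝔽₂ⁿ`. -/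
noncomputable def agreement {n : ℕ} (f g : F2 n → ZMod 2) : ℝ :=
  ((Finset.univ.filter fun x => f x = g x).card : ℝ) / Fintype.card (F2 n)

/-- The polynomial Freiman–Ruzsa conjecture over `𝔽₂`: a nonempty `S ⊆ 𝔽₂ⁿ` with
`|S + S| ≤ K |S|` has a subset `S'` with `|S'| ≥ K^{-O(1)} |S|` and `|Span S'| ≤ K^{O(1)} |S|`.
Here `K^{O(1)}` stands for `C * K ^ C` with an absolute constant `C`. -/
def PolynomialFreimanRuzsa : Prop :=
  ∃ C : ℕ, 0 < C ∧ ∀ (n : ℕ) (S : Finset (F2 n)) (K : ℝ), S.Nonempty →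
    ((S + S).card : ℝ) ≤ K * (S.card : ℝ) →
      ∃ S' : Finset (F2 n), S' ⊆ S ∧
        (S.card : ℝ) / (C * K ^ C) ≤ (S'.card : ℝ) ∧
        (Nat.card (Submodule.span (ZMod 2) (S' : Set (F2 n))) : ℝ) ≤ C * K ^ C * (S.card : ℝ)

/-- The polynomial inverse Gowers conjecture for `U³` over `𝔽₂`: if `‖(-1)^f‖_{U³} ≥ ε > 0` then
`Pr[f = p] ≥ 1/2 + ε^{O(1)}` for some polynomial `p` of degree at most two.
Here `ε^{O(1)}` stands for `ε ^ C / C` with an absolute constant `C`. -/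
def PolynomialInverseGowersU3 : Prop :=
  ∃ C : ℕ, 0 < C ∧ ∀ (n : ℕ) (f : F2 n → ZMod 2) (ε : ℝ), 0 < ε →
    ε ≤ gowersNorm 3 (signFun f) →
      ∃ p : MvPolynomial (Fin n) (ZMod 2), p.totalDegree ≤ 2 ∧
        1 / 2 + ε ^ C / C ≤ agreement f (fun x => MvPolynomial.eval x p)

open scoped BigOperators Pointwise

/-! From Freiman–Ruzsa to inverse Gowers. For `F = (-1)^f` on a space of size `N`, let `p(h, χ)` be
the squared Fourier coefficient at `χ` of the derivative of `F` in direction `h` (`derivSpectrum`).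
It has total mass `N`, and a large `U³` norm makes `∑ p²` comparable to `N`; Hölder then does the
same for `∑ p⁴`. The key fact is `charTransform_derivSpectrum`: under the symplectic pairing of
phase space, `p` is its own Fourier transform up to the factor `N`. It is used twice. The fourth
moment of `p` becomes its additive energy, so a level set of `p` has many additive quadruples, and
`balog_szemeredi_gowers` with Freiman–Ruzsa produces a subspace of size about `N` carrying much of
`p`. Also, `p` is positive definite, so its average over a subspace does not decrease on passing to
a smaller subspace.

This monotonicity replaces the subspace by the graph of a matrix `M` (`exists_matrix_of_submodule`).
A Cauchy–Schwarz argument shows that the symmetrisation of `M` has a large radical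
(`sum_graph_sq_le`), so that `M` can be traded for an alternating matrix (`exists_alternating`). An
alternating matrix is the polarisation of a quadratic form; dividing `F` by that quadratic phase
leaves a function of large `U²` norm, hence with a large Fourier coefficient
(`exists_quadratic_correlation`).

From inverse Gowers to Freiman–Ruzsa. A set `S` of small doubling is modelled by a dense set `T` in
a space `V` with a lift `s : V → 𝔽₂ⁿ` that respects additive quadruples of `T`
(`exists_dense_model`). If `f` extends `s`, the function `(x, z) ↦ f(x) · z` has large `U³` norm:
cubes over `T` contribute fully, and all others contribute nonnegatively. A quadratic correlating
with it has a bilinear mixed part, which supplies an affine map agreeing with `f` on many points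
(`PolynomialInverseGowersU3.exists_affine`). Off `T`, the values of `f` are chosen linearly
independent in extra coordinates, so agreement there is only logarithmic in `|V|`. Hence the affine
map agrees with `s` on much of `T`, and the matching part of `S` lies in a small span, unless `V` is
so small that a single point suffices. -/

open scoped Classical in
/-- The nontrivial additive character of `ZMod 2`, with real values. -/
noncomputable def sgn (a : ZMod 2) : ℝ := if a = 0 then 1 else -1

lemma sgn_zero : sgn 0 = 1 := by simp [sgn]

lemma sgn_one : sgn 1 = -1 := by simp [sgn]

lemma zmod_two_cases (a : ZMod 2) : a = 0 ∨ a = 1 := by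
  revert a; decide

lemma sgn_add (a b : ZMod 2) : sgn (a + b) = sgn a * sgn b := by
  have h : (1 + 1 : ZMod 2) = 0 := by decide
  rcases zmod_two_cases a with rfl | rfl <;> rcases zmod_two_cases b with rfl | rfl <;>
    simp [sgn_zero, sgn_one, h]

lemma sgn_mul_self (a : ZMod 2) : sgn a * sgn a = 1 := by
  rcases zmod_two_cases a with rfl | rfl <;> simp [sgn_zero, sgn_one]

lemma sgn_le_one (a : ZMod 2) : sgn a ≤ 1 := by
  rcases zmod_two_cases a with rfl | rfl <;> simp [sgn_zero, sgn_one]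

lemma neg_one_pow_val (a : ZMod 2) : ((-1 : ℂ)) ^ a.val = (sgn a : ℂ) := by
  rcases zmod_two_cases a with rfl | rfl <;> simp [sgn_zero, sgn_one, ZMod.val_one]

/-! ### Character sums and positive definite functions -/

section Characters

variable {E : Type*} [AddCommGroup E] [Fintype E]

lemma sum_sgn_eq_zero {χ : E →+ ZMod 2} (h : χ ≠ 0) : ∑ a, sgn (χ a) = 0 := by
  obtain ⟨a, ha⟩ : ∃ a, χ a ≠ 0 := by
    by_contra! hc
    exact h (AddMonoidHom.ext hc)
  have ha1 : χ a = 1 := (zmod_two_cases _).resolve_left ha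
  have h2 : ∑ x, sgn (χ (x + a)) = ∑ x, sgn (χ x) :=
    Fintype.sum_equiv (Equiv.addRight a) _ _ fun _ => rfl
  simp only [map_add, sgn_add, ha1, sgn_one, ← Finset.sum_mul] at h2
  linarith

lemma sum_sgn_nonneg (χ : E →+ ZMod 2) : 0 ≤ ∑ a, sgn (χ a) := by
  by_cases h : χ = 0
  · simp [h, sgn_zero]
  · rw [sum_sgn_eq_zero h]

open scoped Classical in
lemma sum_sgn (χ : E →+ ZMod 2) :
    ∑ a, sgn (χ a) = if χ = 0 then (Fintype.card E : ℝ) else 0 := by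
  split_ifs with h
  · simp [h, sgn_zero]
  · exact sum_sgn_eq_zero h

open scoped Classical in
lemma sum_sgn_subgroup_nonneg (L : AddSubgroup E) (χ : E →+ ZMod 2) :
    0 ≤ ∑ a with a ∈ L, sgn (χ a) := by
  have := sum_sgn_nonneg (χ.comp L.subtype)
  rwa [Finset.sum_subtype (p := fun a => a ∈ L) _ (by simp)]

/-- A function which is a nonnegative combination of characters. -/
def IsPosDef (p : E → ℝ) : Prop :=
  ∃ (w : E → ℝ) (e : E → E →+ ZMod 2), (∀ ξ, 0 ≤ w ξ) ∧ ∀ a, p a = ∑ ξ, w ξ * sgn (e ξ a)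

-- The sum of a character over `L` is nonnegative, and the shift by `c` only multiplies it by a
-- sign.
open scoped Classical in
lemma IsPosDef.sum_coset_le {p : E → ℝ} (hp : IsPosDef p) (L : AddSubgroup E) (c : E) :
    ∑ a with a ∈ L, p (a + c) ≤ ∑ a with a ∈ L, p a := by
  obtain ⟨w, e, hw, hp⟩ := hp
  simp only [hp, map_add, sgn_add]
  rw [Finset.sum_comm, Finset.sum_comm (γ := E) (s := Finset.univ.filter (· ∈ L))]
  refine Finset.sum_le_sum fun ξ _ => ?_
  rw [← Finset.mul_sum, ← Finset.mul_sum, ← Finset.sum_mul]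
  refine mul_le_mul_of_nonneg_left ?_ (hw ξ)
  exact mul_le_of_le_one_right (sum_sgn_subgroup_nonneg L (e ξ)) (sgn_le_one _)

open scoped Classical in
lemma sum_subgroup_add (L : AddSubgroup E) (g : E → ℝ) {c : E} (hc : c ∈ L) :
    ∑ a with a ∈ L, g (a + c) = ∑ a with a ∈ L, g a := by
  refine Finset.sum_equiv (Equiv.addRight c) (fun a => ?_) fun _ _ => rfl
  simp [L.add_mem_cancel_right hc]

-- The average over `L'` is an average of averages over cosets of `L`, none of which exceeds the
-- average over `L`. This is the monotonicity used whenever a subspace is replaced by a smaller one.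
open scoped Classical in
lemma IsPosDef.card_mul_sum_le {p : E → ℝ} (hp : IsPosDef p) {L L' : AddSubgroup E}
    (h : L ≤ L') :
    (Finset.card {a | a ∈ L} : ℝ) * ∑ a with a ∈ L', p a
      ≤ (Finset.card {a | a ∈ L'} : ℝ) * ∑ a with a ∈ L, p a := by
  calc (Finset.card {a | a ∈ L} : ℝ) * ∑ a with a ∈ L', p a
      = ∑ a with a ∈ L, ∑ c with c ∈ L', p (c + a) := by
        rw [Finset.sum_congr rfl fun a ha =>
          sum_subgroup_add L' p (h (by simpa using ha)), Finset.sum_const, nsmul_eq_mul]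
    _ = ∑ c with c ∈ L', ∑ a with a ∈ L, p (a + c) := by
        rw [Finset.sum_comm]; simp only [add_comm]
    _ ≤ ∑ c with c ∈ L', ∑ a with a ∈ L, p a :=
        Finset.sum_le_sum fun c _ => hp.sum_coset_le L c
    _ = _ := by rw [Finset.sum_const, nsmul_eq_mul]

end Characters

/-! ### Parseval and additive quadruples -/

section Fourier

variable {E : Type*} [AddCommGroup E]

lemma add_eq_zero_iff_eq_of_two [Module (ZMod 2) E] {a b : E} : a + b = 0 ↔ b = a := by
  rw [add_eq_zero_iff_eq_neg, ZModModule.neg_eq_self]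
  exact eq_comm

variable [Fintype E]

/-- The unnormalised Fourier transform with respect to a pairing. -/
noncomputable def charTransform (e : E →+ E →+ ZMod 2) (g : E → ℝ) (ξ : E) : ℝ :=
  ∑ a, g a * sgn (e a ξ)

open scoped Classical in
lemma sum_sgn_pairing {e : E →+ E →+ ZMod 2} (he : Function.Injective e) (a : E) :
    ∑ ξ, sgn (e a ξ) = if a = 0 then (Fintype.card E : ℝ) else 0 := by
  rw [sum_sgn]
  simp [map_eq_zero_iff e he]

variable [Module (ZMod 2) E]

lemma sum_charTransform_sq {e : E →+ E →+ ZMod 2} (he : Function.Injective e) (g : E → ℝ) :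
    ∑ ξ, charTransform e g ξ ^ 2 = Fintype.card E * ∑ a, g a ^ 2 := by
  classical
  have h : ∀ ξ, charTransform e g ξ ^ 2 = ∑ a, ∑ b, g a * g b * sgn (e (a + b) ξ) := by
    intro ξ
    rw [sq, charTransform, Finset.sum_mul_sum]
    simp only [map_add, AddMonoidHom.add_apply, sgn_add]
    exact Finset.sum_congr rfl fun a _ => Finset.sum_congr rfl fun b _ => by ring
  simp only [h]
  rw [Finset.sum_comm, Finset.mul_sum]
  refine Finset.sum_congr rfl fun a _ => ?_
  rw [Finset.sum_comm]
  simp only [← Finset.mul_sum, sum_sgn_pairing he, add_eq_zero_iff_eq_of_two]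
  simp
  ring

/-- The number of weighted additive quadruples. -/
def quadSum (g : E → ℝ) : ℝ := ∑ a, ∑ b, ∑ c, g a * g b * g c * g (a + b + c)

/-- Orthogonality keeps only the quadruples of sum zero, and in characteristic two the fourth entry
is then `a + b + c`. -/
lemma sum_charTransform_pow_four {e : E →+ E →+ ZMod 2} (he : Function.Injective e) (g : E → ℝ) :
    ∑ ξ, charTransform e g ξ ^ 4 = Fintype.card E * quadSum g := by
  classical
  have h : ∀ ξ, charTransform e g ξ ^ 4
      = ∑ a, ∑ b, ∑ c, ∑ d, g a * g b * g c * g d * sgn (e (a + b + c + d) ξ) := by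
    intro ξ
    have : charTransform e g ξ ^ 4
        = charTransform e g ξ * (charTransform e g ξ * (charTransform e g ξ * charTransform e g ξ)) := by ring
    rw [this]
    simp only [charTransform, Finset.mul_sum, Finset.sum_mul,
      map_add, AddMonoidHom.add_apply, sgn_add]
    rw [Finset.sum_comm]
    refine Finset.sum_congr rfl fun a _ => ?_
    refine Finset.sum_congr rfl fun b _ => ?_
    refine Finset.sum_congr rfl fun c _ => ?_
    refine Finset.sum_congr rfl fun d _ => ?_
    ring
  simp only [h, quadSum]
  rw [Finset.sum_comm, Finset.mul_sum]
  refine Finset.sum_congr rfl fun a _ => ?_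
  rw [Finset.sum_comm, Finset.mul_sum]
  refine Finset.sum_congr rfl fun b _ => ?_
  rw [Finset.sum_comm, Finset.mul_sum]
  refine Finset.sum_congr rfl fun c _ => ?_
  rw [Finset.sum_comm]
  simp only [← Finset.mul_sum, sum_sgn_pairing he, add_eq_zero_iff_eq_of_two]
  simp
  ring

end Fourier

/-! ### The dot product and the symplectic pairing -/

section Dot

variable {ι : Type*} [Fintype ι]

/-- The dot product as a pairing. -/
def dotPairing (ι : Type*) [Fintype ι] : (ι → ZMod 2) →+ (ι → ZMod 2) →+ ZMod 2 :=
  AddMonoidHom.mk' (fun x => AddMonoidHom.mk' (fun y => x ⬝ᵥ y) (dotProduct_add x))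
    fun x y => by ext z; simp [add_dotProduct]

@[simp] lemma dotPairing_apply (x y : ι → ZMod 2) : dotPairing ι x y = x ⬝ᵥ y := rfl

lemma dotPairing_injective : Function.Injective (dotPairing ι) := by
  classical
  intro x y h
  ext i
  have := DFunLike.congr_fun h (Pi.single i 1)
  simpa using this

/-- The pairing on phase space which exchanges position and frequency. -/
def phasePairing (ι : Type*) [Fintype ι] :
    (ι → ZMod 2) × (ι → ZMod 2) →+ (ι → ZMod 2) × (ι → ZMod 2) →+ ZMod 2 :=
  AddMonoidHom.mk' (fun a => AddMonoidHom.mk' (fun b => a.1 ⬝ᵥ b.2 + a.2 ⬝ᵥ b.1)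
      fun b c => by simp [dotProduct_add]; ring)
    fun a b => by ext1 c; simp [add_dotProduct]; ring

@[simp] lemma phasePairing_apply (a b : (ι → ZMod 2) × (ι → ZMod 2)) :
    phasePairing ι a b = a.1 ⬝ᵥ b.2 + a.2 ⬝ᵥ b.1 := rfl

lemma phasePairing_injective : Function.Injective (phasePairing ι) := by
  intro a b h
  refine Prod.ext (dotPairing_injective ?_) (dotPairing_injective ?_) <;> ext1 z
  · simpa using DFunLike.congr_fun h (0, z)
  · simpa using DFunLike.congr_fun h (z, 0)

end Dot

/-! ### The spectrum of derivatives on phase space -/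

section PhaseSpace

variable {n : ℕ}

lemma F2.add_self (x : F2 n) : x + x = 0 := ZModModule.add_self x

/-- The squared Fourier coefficients of the multiplicative derivatives of `F`. -/
noncomputable def derivSpectrum (F : F2 n → ℝ) (a : F2 n × F2 n) : ℝ :=
  ((∑ x, F x * F (x + a.1) * sgn (a.2 ⬝ᵥ x)) / Fintype.card (F2 n)) ^ 2

lemma card_F2_pos : (0 : ℝ) < Fintype.card (F2 n) := by
  exact_mod_cast Fintype.card_pos

lemma derivSpectrum_nonneg (F : F2 n → ℝ) (a : F2 n × F2 n) : 0 ≤ derivSpectrum F a :=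
  sq_nonneg _

lemma derivSpectrum_eq (F : F2 n → ℝ) (h χ : F2 n) :
    derivSpectrum F (h, χ) = (∑ x, ∑ y, F x * F (x + h) * (F y * F (y + h)) *
      sgn (χ ⬝ᵥ (x + y))) / (Fintype.card (F2 n) : ℝ) ^ 2 := by
  rw [derivSpectrum, div_pow, sq (∑ x, _), Finset.sum_mul_sum]
  simp only [dotProduct_add, sgn_add]
  congr 1
  exact Finset.sum_congr rfl fun x _ => Finset.sum_congr rfl fun y _ => by ring

lemma sum_sgn_dot_right {ι : Type*} [Fintype ι] [DecidableEq ι] (y : ι → ZMod 2) :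
    ∑ x : ι → ZMod 2, sgn (x ⬝ᵥ y) = if y = 0 then (Fintype.card (ι → ZMod 2) : ℝ) else 0 := by
  classical
  have := sum_sgn_pairing (dotPairing_injective (ι := ι)) y
  simp only [dotPairing_apply] at this
  rw [Finset.sum_congr rfl fun x _ => by rw [dotProduct_comm x y], this]
  congr

/-- The function `derivSpectrum F` is its own Fourier transform up to normalisation. -/
lemma charTransform_derivSpectrum (F : F2 n → ℝ) (b : F2 n × F2 n) :
    charTransform (phasePairing (Fin n)) (derivSpectrum F) b
      = Fintype.card (F2 n) * derivSpectrum F b := by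
  obtain ⟨t, ξ⟩ := b
  have hN := (card_F2_pos (n := n)).ne'
  have key : ∀ h : F2 n, ∑ χ : F2 n, derivSpectrum F (h, χ) * sgn (h ⬝ᵥ ξ + χ ⬝ᵥ t)
      = (∑ x, F x * F (x + t) * (F (x + h) * F (x + h + t)) * sgn (h ⬝ᵥ ξ))
        / Fintype.card (F2 n) := by
    intro h
    -- In this form the sum over `χ` forces `y = x + t`, leaving a single sum over `x`.
    have h1 : ∀ χ : F2 n, derivSpectrum F (h, χ) * sgn (h ⬝ᵥ ξ + χ ⬝ᵥ t)
        = (∑ x, ∑ y, F x * F (x + h) * (F y * F (y + h)) * sgn (h ⬝ᵥ ξ) *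
          sgn (χ ⬝ᵥ (x + t + y))) / (Fintype.card (F2 n) : ℝ) ^ 2 := by
      intro χ
      rw [derivSpectrum_eq, div_mul_eq_mul_div, Finset.sum_mul]
      congr 1
      refine Finset.sum_congr rfl fun x _ => ?_
      rw [Finset.sum_mul]
      refine Finset.sum_congr rfl fun y _ => ?_
      simp only [dotProduct_add, sgn_add]
      ring
    simp only [h1]
    rw [← Finset.sum_div, Finset.sum_comm]
    rw [div_eq_div_iff (by positivity) hN, Finset.sum_mul, Finset.sum_mul]
    refine Finset.sum_congr rfl fun x _ => ?_
    rw [Finset.sum_comm]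
    simp only [← Finset.mul_sum, sum_sgn_dot_right, add_eq_zero_iff_eq_of_two]
    simp only [mul_ite, mul_zero, Finset.sum_ite_eq', Finset.mem_univ, if_true,
      add_right_comm x t h]
    ring
  simp only [charTransform, phasePairing_apply]
  rw [Fintype.sum_prod_type]
  simp only [key]
  rw [← Finset.sum_div, Finset.sum_comm, derivSpectrum_eq, div_eq_iff hN, mul_assoc, mul_comm,
    mul_assoc, ← sq, div_mul_cancel₀ _ (pow_ne_zero 2 hN)]
  refine Finset.sum_congr rfl fun x _ => ?_
  -- With `y = x + h`, the four points are `x, x + t, y, y + t`: the directions `h` and `t` have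
  -- exchanged roles, which is the self-duality.
  refine Fintype.sum_equiv (Equiv.addLeft x) _ _ fun h => ?_
  simp [← add_assoc, F2.add_self, dotProduct_comm]

/-- Self-duality writes the spectrum as a combination of characters whose weights are its own,
nonnegative, values divided by `N`. -/
lemma derivSpectrum_isPosDef (F : F2 n → ℝ) : IsPosDef (derivSpectrum F) := by
  refine ⟨fun ξ => derivSpectrum F ξ / Fintype.card (F2 n), phasePairing (Fin n),
    fun ξ => div_nonneg (derivSpectrum_nonneg F ξ) (Nat.cast_nonneg _), fun a => ?_⟩
  have h := charTransform_derivSpectrum F a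
  have hN := (card_F2_pos (n := n)).ne'
  rw [eq_comm, mul_comm, ← eq_div_iff hN] at h
  rw [h, charTransform, Finset.sum_div]
  exact Finset.sum_congr rfl fun ξ _ => by ring

/-- Parseval for the derivative in direction `h`, which again takes values `±1`. -/
lemma sum_derivSpectrum_right {F : F2 n → ℝ} (hF : ∀ x, F x * F x = 1) (h : F2 n) :
    ∑ χ, derivSpectrum F (h, χ) = 1 := by
  have hN := (card_F2_pos (n := n)).ne'
  have := sum_charTransform_sq (dotPairing_injective (ι := Fin n)) (fun x => F x * F (x + h))
  have h2 : ∀ x, (F x * F (x + h)) ^ 2 = 1 := fun x => by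
    rw [mul_pow, sq, sq, hF, hF, one_mul]
  simp only [h2, Finset.sum_const, Finset.card_univ, nsmul_eq_mul, mul_one] at this
  simp only [derivSpectrum, div_pow]
  rw [← Finset.sum_div, div_eq_one_iff_eq (pow_ne_zero 2 hN), sq, ← this]
  simp only [charTransform, dotPairing_apply, dotProduct_comm]

lemma derivSpectrum_le_one {F : F2 n → ℝ} (hF : ∀ x, F x * F x = 1) (a : F2 n × F2 n) :
    derivSpectrum F a ≤ 1 := by
  rw [← sum_derivSpectrum_right hF a.1]
  exact Finset.single_le_sum (f := fun χ => derivSpectrum F (a.1, χ))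
    (fun χ _ => derivSpectrum_nonneg F _) (Finset.mem_univ a.2)

lemma sum_derivSpectrum {F : F2 n → ℝ} (hF : ∀ x, F x * F x = 1) :
    ∑ a, derivSpectrum F a = Fintype.card (F2 n) := by
  rw [Fintype.sum_prod_type]
  simp [sum_derivSpectrum_right hF]

/-- The additive energy of the weight `derivSpectrum F`. -/
lemma quadSum_derivSpectrum (F : F2 n → ℝ) :
    quadSum (derivSpectrum F)
      = (Fintype.card (F2 n) : ℝ) ^ 2 * ∑ a, derivSpectrum F a ^ 4 := by
  have h := sum_charTransform_pow_four (phasePairing_injective (ι := Fin n)) (derivSpectrum F)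
  have hN := (card_F2_pos (n := n)).ne'
  simp only [charTransform_derivSpectrum, mul_pow, ← Finset.mul_sum, Fintype.card_prod,
    Nat.cast_mul] at h
  apply mul_left_cancel₀ (mul_ne_zero hN hN)
  rw [← h]
  ring

/-- Hölder between the moments of order 1, 2 and 4, obtained from two applications of Cauchy–Schwarz
through the third moment. -/
lemma sum_sq_pow_three_le {α : Type*} (s : Finset α) (p : α → ℝ) (hp : ∀ a, 0 ≤ p a) :
    (∑ a ∈ s, p a ^ 2) ^ 3 ≤ (∑ a ∈ s, p a) ^ 2 * ∑ a ∈ s, p a ^ 4 := by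
  have h1 : (∑ a ∈ s, p a ^ 2) ^ 2 ≤ (∑ a ∈ s, p a) * ∑ a ∈ s, p a ^ 3 :=
    Finset.sum_sq_le_sum_mul_sum_of_sq_le_mul s (fun a _ => hp a) (fun a _ => pow_nonneg (hp a) 3)
      fun a _ => (by ring : (p a ^ 2) ^ 2 = p a * p a ^ 3).le
  have h2 : (∑ a ∈ s, p a ^ 3) ^ 2 ≤ (∑ a ∈ s, p a ^ 2) * ∑ a ∈ s, p a ^ 4 :=
    Finset.sum_sq_le_sum_mul_sum_of_sq_le_mul s (fun a _ => pow_nonneg (hp a) 2)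
      (fun a _ => pow_nonneg (hp a) 4)
      fun a _ => (by ring : (p a ^ 3) ^ 2 = p a ^ 2 * p a ^ 4).le
  have n1 : 0 ≤ ∑ a ∈ s, p a := Finset.sum_nonneg fun a _ => hp a
  have n2 : 0 ≤ ∑ a ∈ s, p a ^ 2 := Finset.sum_nonneg fun a _ => by positivity
  have n3 : 0 ≤ ∑ a ∈ s, p a ^ 3 := Finset.sum_nonneg fun a _ => pow_nonneg (hp a) 3
  have n4 : 0 ≤ ∑ a ∈ s, p a ^ 4 := Finset.sum_nonneg fun a _ => by positivity
  rcases n2.eq_or_lt with h0 | h0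
  · rw [← h0, zero_pow three_ne_zero]; positivity
  refine le_of_mul_le_mul_left ?_ h0
  calc _ = ((∑ a ∈ s, p a ^ 2) ^ 2) ^ 2 := by ring
    _ ≤ ((∑ a ∈ s, p a) * ∑ a ∈ s, p a ^ 3) ^ 2 := by gcongr
    _ = (∑ a ∈ s, p a) ^ 2 * (∑ a ∈ s, p a ^ 3) ^ 2 := by ring
    _ ≤ (∑ a ∈ s, p a) ^ 2 * ((∑ a ∈ s, p a ^ 2) * ∑ a ∈ s, p a ^ 4) := by gcongr
    _ = _ := by ring

end PhaseSpace

/-! ### Additive energy of a level set -/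

section LevelSet

variable {E : Type*} [AddCommGroup E] [Fintype E] [DecidableEq E]

/-- The number of triples in `A` whose sum lies in `A`. -/
noncomputable def quadCount (A : Finset E) : ℝ :=
  quadSum fun a => if a ∈ A then 1 else 0

/-- A quadruple with an entry outside `A` weighs at most `η` times the product of the other three.
Any three entries of a quadruple are free, so each of the four positions costs `η (∑ p)³`. -/
lemma quadSum_le_quadCount_add {p : E → ℝ} (hp : ∀ a, 0 ≤ p a) (hp1 : ∀ a, p a ≤ 1) {η : ℝ}
    (hη : 0 ≤ η) {A : Finset E} (hA : ∀ a, a ∉ A → p a ≤ η) :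
    quadSum p ≤ quadCount A + 4 * (η * (∑ a, p a) ^ 3) := by
  have e1 : ∑ a, ∑ b, ∑ c, p a * p b * p c = (∑ a, p a) ^ 3 := by
    simp only [← Finset.mul_sum, ← Finset.sum_mul]
    ring
  have e2 : ∑ a, ∑ b, ∑ c, p a * p b * p (a + b + c) = (∑ a, p a) ^ 3 := by
    rw [← e1]
    refine Finset.sum_congr rfl fun a _ => Finset.sum_congr rfl fun b _ => ?_
    exact Fintype.sum_equiv (Equiv.addLeft (a + b)) _ _ fun _ => rfl
  have e3 : ∑ a, ∑ b, ∑ c, p a * p c * p (a + b + c) = (∑ a, p a) ^ 3 := by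
    rw [← e2]
    refine Finset.sum_congr rfl fun a _ => ?_
    rw [Finset.sum_comm]
    simp only [add_right_comm]
  have e4 : ∑ a, ∑ b, ∑ c, p b * p c * p (a + b + c) = (∑ a, p a) ^ 3 := by
    rw [← e3, Finset.sum_comm]
    simp only [add_comm]
  have key : ∀ a b c, p a * p b * p c * p (a + b + c) ≤
      ((if a ∈ A then 1 else 0) * (if b ∈ A then 1 else 0) * (if c ∈ A then 1 else 0) *
        (if a + b + c ∈ A then 1 else 0)) +
      (η * (p a * p b * p c) + η * (p a * p b * p (a + b + c)) + η * (p a * p c * p (a + b + c))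
        + η * (p b * p c * p (a + b + c))) := by
    intro a b c
    have n1 : 0 ≤ p a * p b * p c := mul_nonneg (mul_nonneg (hp _) (hp _)) (hp _)
    have n2 : 0 ≤ p a * p b * p (a + b + c) := mul_nonneg (mul_nonneg (hp _) (hp _)) (hp _)
    have n3 : 0 ≤ p a * p c * p (a + b + c) := mul_nonneg (mul_nonneg (hp _) (hp _)) (hp _)
    have n4 : 0 ≤ p b * p c * p (a + b + c) := mul_nonneg (mul_nonneg (hp _) (hp _)) (hp _)
    have m1 := mul_nonneg hη n1
    have m2 := mul_nonneg hη n2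
    have m3 := mul_nonneg hη n3
    have m4 := mul_nonneg hη n4
    by_cases ha : a ∈ A
    · by_cases hb : b ∈ A
      · by_cases hc : c ∈ A
        · by_cases hd : a + b + c ∈ A
          · simp only [ha, hb, hc, hd, if_true, mul_one]
            have : p a * p b * p c * p (a + b + c) ≤ 1 := by
              refine mul_le_one₀ (mul_le_one₀ (mul_le_one₀ (hp1 _) (hp _) (hp1 _)) (hp _) (hp1 _))
                (hp _) (hp1 _)
            linarith
          · simp only [hd, if_false, mul_zero]
            have := mul_le_mul_of_nonneg_right (hA _ hd) n1
            linarith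
        · simp only [hc, if_false, mul_zero, zero_mul]
          have := mul_le_mul_of_nonneg_right (hA _ hc) n2
          linarith
      · simp only [hb, if_false, mul_zero, zero_mul]
        have := mul_le_mul_of_nonneg_right (hA _ hb) n3
        linarith
    · simp only [ha, if_false, zero_mul]
      have := mul_le_mul_of_nonneg_right (hA _ ha) n4
      linarith
  calc quadSum p ≤ _ := Finset.sum_le_sum fun a _ => Finset.sum_le_sum fun b _ =>
        Finset.sum_le_sum fun c _ => key a b c
    _ = _ := by
      simp only [Finset.sum_add_distrib, ← Finset.mul_sum _ _ η, e1, e2, e3, e4, quadCount, quadSum]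
      ring

end LevelSet

/-! ### The Balog–Szemerédi–Gowers theorem -/

section BalogSzemerediGowers

/-- Dependent random choice: in a dense relation some neighbourhood is large and has few pairs of
small codegree. -/
lemma exists_neighborhood_few_bad {α : Type*} (A : Finset α) (r : α → α → Prop)
    [DecidableRel r] {δ : ℝ} (hδ : 0 < δ) (hA : A.Nonempty)
    (hr : δ * (A.card : ℝ) ^ 2 ≤ ∑ v ∈ A, ((A.filter fun a => r a v).card : ℝ)) :
    ∃ U ⊆ A, δ / 2 * (A.card : ℝ) ≤ U.card ∧
      ∑ a ∈ U, ((U.filter fun b =>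
        ((A.filter fun w => r a w ∧ r b w).card : ℝ) < δ ^ 2 / 16 * A.card).card : ℝ)
        ≤ (U.card : ℝ) ^ 2 / 8 := by
  classical
  have hA0 : (0 : ℝ) < A.card := by exact_mod_cast hA.card_pos
  let bad : α → α → Prop := fun a b =>
    ((A.filter fun w => r a w ∧ r b w).card : ℝ) < δ ^ 2 / 16 * A.card
  let U : α → Finset α := fun v => A.filter fun a => r a v
  let B : α → ℝ := fun v => ∑ a ∈ U v, (((U v).filter fun b => bad a b).card : ℝ)
  have hB : ∑ v ∈ A, B v ≤ (A.card : ℝ) ^ 2 * (δ ^ 2 / 16 * A.card) := by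
    have h1 : ∀ v, B v = ∑ a ∈ A, ∑ b ∈ A, if bad a b then (if r a v ∧ r b v then 1 else 0) else 0 := by
      intro v
      simp only [B, U, Finset.card_filter, Finset.sum_filter, Nat.cast_sum, Finset.filter_filter]
      refine Finset.sum_congr rfl fun a _ => ?_
      by_cases ha : r a v
      · simp only [ha, if_true, true_and]
        refine Finset.sum_congr rfl fun b _ => ?_
        by_cases hb : r b v <;> by_cases hab : bad a b <;> simp [hb, hab]
      · simp [ha]
    calc ∑ v ∈ A, B v = ∑ a ∈ A, ∑ b ∈ A, if bad a b then
          ((A.filter fun w => r a w ∧ r b w).card : ℝ) else 0 := by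
          simp only [h1]
          rw [Finset.sum_comm]
          refine Finset.sum_congr rfl fun a _ => ?_
          rw [Finset.sum_comm]
          refine Finset.sum_congr rfl fun b _ => ?_
          by_cases hab : bad a b <;> simp [hab]
      _ ≤ ∑ a ∈ A, ∑ b ∈ A, δ ^ 2 / 16 * A.card := by
          refine Finset.sum_le_sum fun a _ => Finset.sum_le_sum fun b _ => ?_
          split_ifs with hab
          · exact le_of_lt hab
          · positivity
      _ = _ := by simp only [Finset.sum_const, nsmul_eq_mul]; ring
  have hcs : (δ * (A.card : ℝ) ^ 2) ^ 2 ≤ A.card * ∑ v ∈ A, ((U v).card : ℝ) ^ 2 :=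
    (pow_le_pow_left₀ (by positivity) hr 2).trans sq_sum_le_card_mul_sum_sq
  -- Cauchy–Schwarz gives `∑ |U v|² ≥ δ² |A|³`, while `8 ∑ B v ≤ δ² |A|³ / 2`. A `v` with `|U v|² -
  -- 8 B v` at least average satisfies both requirements at once.
  have hsum : ∑ v ∈ A, δ ^ 2 / 2 * (A.card : ℝ) ^ 2
      ≤ ∑ v ∈ A, (((U v).card : ℝ) ^ 2 - 8 * B v) := by
    rw [Finset.sum_sub_distrib, ← Finset.mul_sum, Finset.sum_const, nsmul_eq_mul]
    have : δ ^ 2 * (A.card : ℝ) ^ 3 ≤ ∑ v ∈ A, ((U v).card : ℝ) ^ 2 := by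
      refine le_of_mul_le_mul_left ?_ hA0
      linarith
    rw [← Finset.mul_sum]
    linarith
  obtain ⟨v, hv, hvU⟩ := Finset.exists_le_of_sum_le hA hsum
  have hB0 : 0 ≤ B v := Finset.sum_nonneg fun a _ => Nat.cast_nonneg _
  refine ⟨U v, Finset.filter_subset _ _, ?_, ?_⟩
  · refine (sq_le_sq₀ (by positivity) (Nat.cast_nonneg _)).1 ?_
    nlinarith [sq_nonneg (δ * (A.card : ℝ))]
  · change B v ≤ _
    nlinarith [sq_nonneg (δ * (A.card : ℝ))]

/-- In a set with few bad pairs, half of the elements share with each other half of the set as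
good partners. -/
lemma exists_half_good {α : Type*} (U : Finset α) (bad : α → α → Prop) [DecidableRel bad]
    (h : ∑ a ∈ U, ((U.filter fun b => bad a b).card : ℝ) ≤ (U.card : ℝ) ^ 2 / 8) :
    ∃ A' ⊆ U, (U.card : ℝ) / 2 ≤ A'.card ∧ ∀ a ∈ A', ∀ b ∈ A',
      (U.card : ℝ) / 2 ≤ (U.filter fun u => ¬ bad a u ∧ ¬ bad b u).card := by
  classical
  -- By Markov, at most half of `U` has more than `|U| / 4` bad partners; two of the remaining
  -- elements together exclude at most half of `U`.
  refine ⟨U.filter fun a => ((U.filter fun b => bad a b).card : ℝ) ≤ U.card / 4,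
    Finset.filter_subset _ _, ?_, ?_⟩
  · set A' := U.filter fun a => ((U.filter fun b => bad a b).card : ℝ) ≤ U.card / 4
    have h1 : ∑ a ∈ U, ((U.card : ℝ) / 4 - if a ∈ A' then (U.card : ℝ) / 4 else 0)
        ≤ (U.card : ℝ) ^ 2 / 8 := by
      refine (Finset.sum_le_sum fun a ha => ?_).trans h
      split_ifs with hA
      · simp
      · have : ¬ ((U.filter fun b => bad a b).card : ℝ) ≤ U.card / 4 := fun hc =>
          hA (Finset.mem_filter.2 ⟨ha, hc⟩)
        linarith
    rw [Finset.sum_sub_distrib, ← Finset.sum_filter, Finset.filter_mem_eq_inter,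
      Finset.inter_eq_right.2 (Finset.filter_subset _ _), Finset.sum_const, Finset.sum_const,
      nsmul_eq_mul, nsmul_eq_mul] at h1
    rcases (Nat.cast_nonneg (α := ℝ) U.card).eq_or_lt with h0 | h0
    · rw [← h0]; simp
    · nlinarith
  · intro a ha b hb
    have ha := (Finset.mem_filter.1 ha).2
    have hb := (Finset.mem_filter.1 hb).2
    have : U.card ≤ (U.filter fun u => ¬ bad a u ∧ ¬ bad b u).card
        + ((U.filter fun u => bad a u).card + (U.filter fun u => bad b u).card) := by
      refine (Finset.card_le_card (t := (U.filter fun u => ¬ bad a u ∧ ¬ bad b u) ∪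
        ((U.filter fun u => bad a u) ∪ (U.filter fun u => bad b u))) fun u hu => ?_).trans
        ((Finset.card_union_le _ _).trans
          (Nat.add_le_add_left (Finset.card_union_le _ _) _))
      simp only [Finset.mem_union, Finset.mem_filter, hu, true_and]
      tauto
    have : (U.card : ℝ) ≤ (U.filter fun u => ¬ bad a u ∧ ¬ bad b u).card
        + ((U.filter fun u => bad a u).card + (U.filter fun u => bad b u).card) := by
      exact_mod_cast this
    linarith

variable {E : Type*} [AddCommGroup E] [DecidableEq E]

/-- The number of representations of `d` as a sum of two elements of `A`. -/
def repCount (A : Finset E) (d : E) : ℝ := ((A.filter fun a => a + d ∈ A).card : ℝ)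

lemma repCount_nonneg (A : Finset E) (d : E) : 0 ≤ repCount A d := Nat.cast_nonneg _

variable [Fintype E]

lemma sum_repCount (A : Finset E) : ∑ d, repCount A d = (A.card : ℝ) ^ 2 := by
  simp only [repCount, Finset.card_filter, Nat.cast_sum]
  rw [Finset.sum_comm]
  have : ∀ a : E, ∑ d, (((if a + d ∈ A then 1 else 0 : ℕ)) : ℝ) = A.card := by
    intro a
    refine (Fintype.sum_equiv (Equiv.addLeft a) _ (fun d => (((if d ∈ A then 1 else 0 : ℕ)) : ℝ))
      fun d => rfl).trans ?_
    simp
  simp only [this, Finset.sum_const, nsmul_eq_mul, sq]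

lemma quadCount_eq (A : Finset E) : quadCount A = ∑ a ∈ A, ∑ b ∈ A, repCount A (a + b) := by
  have hA : ∀ f : E → ℝ, ∑ a ∈ A, f a = ∑ a, if a ∈ A then f a else 0 := fun f => by
    rw [Finset.sum_ite_mem, Finset.univ_inter]
  simp only [quadCount, quadSum, repCount, Finset.card_filter, Nat.cast_sum]
  rw [hA]
  refine Finset.sum_congr rfl fun a _ => ?_
  by_cases ha : a ∈ A
  · simp only [ha, if_true, one_mul]
    rw [hA]
    refine Finset.sum_congr rfl fun b _ => ?_
    by_cases hb : b ∈ A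
    · simp only [hb, if_true, one_mul]
      rw [hA]
      refine Finset.sum_congr rfl fun c _ => ?_
      rw [add_comm c (a + b)]
      split_ifs <;> simp_all
    · simp [hb]
  · simp [ha]

/-- The number of representations of `d` as a sum of eight elements of `A`. -/
def repCount8 (A : Finset E) (d : E) : ℝ :=
  ∑ x, ∑ y, ∑ z, repCount A x * repCount A y * repCount A z * repCount A (d + x + y + z)

lemma sum_repCount8 (A : Finset E) : ∑ d, repCount8 A d = (A.card : ℝ) ^ 8 := by
  have h : ∀ x y z, ∑ d, repCount A (d + x + y + z) = (A.card : ℝ) ^ 2 := by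
    intro x y z
    rw [← sum_repCount A]
    refine Fintype.sum_equiv (Equiv.addRight (x + y + z)) _ _ fun d => ?_
    simp [add_assoc]
  have h2 : ∑ x, ∑ y, ∑ z, ∑ d, repCount A x * repCount A y * repCount A z *
      repCount A (d + x + y + z) = (A.card : ℝ) ^ 8 := by
    simp only [← Finset.mul_sum, h, ← Finset.sum_mul, sum_repCount]
    ring
  simp only [repCount8]
  rw [← h2, Finset.sum_comm]
  refine Finset.sum_congr rfl fun x _ => ?_
  rw [Finset.sum_comm]
  refine Finset.sum_congr rfl fun y _ => ?_
  rw [Finset.sum_comm]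

variable [Module (ZMod 2) E]

/-- A path `a, w, u, v, b` writes `a + b` as the telescoping sum of its four steps, each of which is
itself represented as a sum of two elements of `A`. -/
lemma sum_path_le_repCount8 (A : Finset E) (a b : E) :
    ∑ u ∈ A, (∑ w ∈ A, repCount A (a + w) * repCount A (w + u)) *
      (∑ w ∈ A, repCount A (b + w) * repCount A (w + u)) ≤ repCount8 A (a + b) := by
  have n := repCount_nonneg A
  have h2 : ∀ x y : E, x + (x + y) = y := fun x y => by
    rw [← add_assoc, ZModModule.add_self, zero_add]
  calc _ ≤ ∑ u, (∑ w, repCount A (a + w) * repCount A (w + u)) *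
        (∑ w, repCount A (b + w) * repCount A (w + u)) := by
        refine (Finset.sum_le_sum fun u _ => ?_).trans
          (Finset.sum_le_univ_sum_of_nonneg fun u => ?_)
        · refine mul_le_mul ?_ ?_ ?_ ?_
          · exact Finset.sum_le_univ_sum_of_nonneg fun w => mul_nonneg (n _) (n _)
          · exact Finset.sum_le_univ_sum_of_nonneg fun w => mul_nonneg (n _) (n _)
          · exact Finset.sum_nonneg fun w _ => mul_nonneg (n _) (n _)
          · exact Finset.sum_nonneg fun w _ => mul_nonneg (n _) (n _)
        · exact mul_nonneg (Finset.sum_nonneg fun w _ => mul_nonneg (n _) (n _))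
            (Finset.sum_nonneg fun w _ => mul_nonneg (n _) (n _))
    _ = ∑ w, ∑ u, ∑ v, repCount A (a + w) * repCount A (w + u) * repCount A (u + v) *
        repCount A (v + b) := by
        rw [Finset.sum_comm]
        refine Finset.sum_congr rfl fun u _ => ?_
        rw [Finset.sum_mul_sum]
        refine Finset.sum_congr rfl fun w _ => Finset.sum_congr rfl fun v _ => ?_
        rw [add_comm b v, add_comm v u]
        ring
    _ = repCount8 A (a + b) := by
        rw [repCount8]
        refine Fintype.sum_equiv (Equiv.addLeft a) _ _ fun w => ?_
        refine Fintype.sum_equiv (Equiv.addLeft w) _ _ fun u => ?_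
        refine Fintype.sum_equiv (Equiv.addLeft u) _ _ fun v => ?_
        simp only [Equiv.coe_addLeft]
        congr 2
        have : a + b + (a + w) + (w + u) + (u + v)
            = (a + (a + (w + (w + (u + (u + (v + b))))))) := by abel
        rw [this, h2, h2, h2]

/-- The Balog–Szemerédi–Gowers theorem in characteristic two. -/
theorem balog_szemeredi_gowers (A : Finset E) (hA : A.Nonempty) {δ : ℝ} (hδ : 0 < δ)
    (hq : 2 * δ * (A.card : ℝ) ^ 3 ≤ quadCount A) :
    ∃ A' ⊆ A, δ / 4 * (A.card : ℝ) ≤ A'.card ∧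
      ((A' + A').card : ℝ) ≤ 4096 / δ ^ 10 * A'.card := by
  have hA0 : (0 : ℝ) < A.card := by exact_mod_cast hA.card_pos
  -- Popular sums: pairs that are not popular account for at most `δ |A|³` quadruples, half of the
  -- assumed number.
  let r : E → E → Prop := fun a b => δ * A.card ≤ repCount A (a + b)
  have hrle : ∀ d, repCount A d ≤ A.card := fun d =>
    Nat.cast_le.2 (Finset.card_filter_le A _)
  have hr : δ * (A.card : ℝ) ^ 2 ≤ ∑ v ∈ A, ((A.filter fun a => r a v).card : ℝ) := by
    have h1 : quadCount A ≤ ∑ a ∈ A, ∑ b ∈ A, (δ * A.card + if r b a then (A.card : ℝ) else 0) := by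
      rw [quadCount_eq]
      refine Finset.sum_le_sum fun a _ => Finset.sum_le_sum fun b _ => ?_
      split_ifs with h
      · have := hrle (a + b)
        have : 0 ≤ δ * (A.card : ℝ) := by positivity
        linarith
      · have : repCount A (b + a) < δ * A.card := not_le.1 h
        rw [add_comm a b]
        linarith
    have h2 : ∑ a ∈ A, ∑ b ∈ A, (δ * A.card + if r b a then (A.card : ℝ) else 0)
        = A.card * (δ * (A.card : ℝ) ^ 2 + ∑ v ∈ A, ((A.filter fun a => r a v).card : ℝ)) := by
      simp only [Finset.sum_add_distrib, Finset.sum_const, nsmul_eq_mul, ← Finset.sum_filter,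
        ← Finset.sum_mul]
      ring
    have h3 : A.card * (2 * δ * (A.card : ℝ) ^ 2) ≤
        A.card * (δ * (A.card : ℝ) ^ 2 + ∑ v ∈ A, ((A.filter fun a => r a v).card : ℝ)) := by
      rw [← h2]
      refine le_trans ?_ (hq.trans h1)
      apply le_of_eq; ring
    have := le_of_mul_le_mul_left h3 hA0
    linarith
  classical
  obtain ⟨U, hUA, hUcard, hU⟩ := exists_neighborhood_few_bad A r hδ hA hr
  obtain ⟨A', hA'U, hA'card, hA'⟩ := exists_half_good U _ hU
  refine ⟨A', hA'U.trans hUA, by linarith, ?_⟩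
  have hgood : ∀ a u, ¬ ((A.filter fun w => r a w ∧ r u w).card : ℝ) < δ ^ 2 / 16 * A.card →
      δ ^ 4 / 16 * (A.card : ℝ) ^ 3 ≤ ∑ w ∈ A, repCount A (a + w) * repCount A (w + u) := by
    intro a u h
    calc δ ^ 4 / 16 * (A.card : ℝ) ^ 3 = δ ^ 2 / 16 * A.card * (δ * A.card * (δ * A.card)) := by
          ring
      _ ≤ (A.filter fun w => r a w ∧ r u w).card * (δ * A.card * (δ * A.card)) := by
          gcongr
          exact not_lt.1 h
      _ = ∑ w ∈ A.filter fun w => r a w ∧ r u w, (δ * A.card * (δ * A.card)) := by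
          rw [Finset.sum_const, nsmul_eq_mul]
      _ ≤ ∑ w ∈ A.filter fun w => r a w ∧ r u w, repCount A (a + w) * repCount A (w + u) := by
          refine Finset.sum_le_sum fun w hw => ?_
          obtain ⟨-, h1, h2⟩ := Finset.mem_filter.1 hw
          rw [add_comm w u]
          exact mul_le_mul h1 h2 (by positivity) (repCount_nonneg _ _)
      _ ≤ _ := Finset.sum_le_sum_of_subset_of_nonneg (Finset.filter_subset _ _)
          fun w _ _ => mul_nonneg (repCount_nonneg _ _) (repCount_nonneg _ _)
  -- There are at least `δ |A| / 4` common good midpoints `u`, and each half of the path through `u`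
  -- has weight at least `δ⁴ |A|³ / 16`. Against the total `|A|⁸` this bounds `|A' + A'|`.
  have h8 : ∀ d ∈ A' + A', δ ^ 9 / 1024 * (A.card : ℝ) ^ 7 ≤ repCount8 A d := by
    intro d hd
    obtain ⟨a, ha, b, hb, rfl⟩ := Finset.mem_add.1 hd
    refine le_trans ?_ (sum_path_le_repCount8 A a b)
    have hc : δ / 4 * (A.card : ℝ) ≤ _ := le_trans (by linarith) (hA' a ha b hb)
    calc δ ^ 9 / 1024 * (A.card : ℝ) ^ 7
        = δ / 4 * A.card * (δ ^ 4 / 16 * (A.card : ℝ) ^ 3 * (δ ^ 4 / 16 * (A.card : ℝ) ^ 3)) := by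
          ring
      _ ≤ _ := mul_le_mul_of_nonneg_right hc (by positivity)
      _ = _ := by rw [← nsmul_eq_mul, ← Finset.sum_const]
      _ ≤ _ := Finset.sum_le_sum fun u hu => by
          obtain ⟨-, h1, h2⟩ := Finset.mem_filter.1 hu
          exact mul_le_mul (hgood a u h1) (hgood b u h2) (by positivity)
            (Finset.sum_nonneg fun w _ => mul_nonneg (repCount_nonneg _ _) (repCount_nonneg _ _))
      _ ≤ _ := Finset.sum_le_sum_of_subset_of_nonneg ((Finset.filter_subset _ _).trans hUA)
          fun u _ _ => mul_nonneg
            (Finset.sum_nonneg fun w _ => mul_nonneg (repCount_nonneg _ _) (repCount_nonneg _ _))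
            (Finset.sum_nonneg fun w _ => mul_nonneg (repCount_nonneg _ _) (repCount_nonneg _ _))
  have hn : ∀ d, 0 ≤ repCount8 A d := fun d => Finset.sum_nonneg fun x _ =>
    Finset.sum_nonneg fun y _ => Finset.sum_nonneg fun z _ => mul_nonneg (mul_nonneg (mul_nonneg
      (repCount_nonneg _ _) (repCount_nonneg _ _)) (repCount_nonneg _ _)) (repCount_nonneg _ _)
  have htot : ((A' + A').card : ℝ) * (δ ^ 9 / 1024 * (A.card : ℝ) ^ 7) ≤ (A.card : ℝ) ^ 8 := by
    rw [← sum_repCount8 A, ← nsmul_eq_mul, ← Finset.sum_const]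
    exact (Finset.sum_le_sum h8).trans (Finset.sum_le_univ_sum_of_nonneg hn)
  have h1 : ((A' + A').card : ℝ) * δ ^ 9 ≤ 1024 * A.card := by
    have h7 : (0 : ℝ) < (A.card : ℝ) ^ 7 := by positivity
    refine le_of_mul_le_mul_right ?_ h7
    nlinarith
  rw [div_mul_eq_mul_div, le_div_iff₀ (by positivity)]
  calc ((A' + A').card : ℝ) * δ ^ 10 = ((A' + A').card * δ ^ 9) * δ := by ring
    _ ≤ 1024 * A.card * δ := by gcongr
    _ = 4096 * (δ / 4 * A.card) := by ring
    _ ≤ 4096 * A'.card := by gcongr; linarith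

end BalogSzemerediGowers

/-! ### Cube sums of real functions -/

section Cubes

variable {E : Type*} [AddCommGroup E]

/-- The multiplicative derivative of a real function. -/
def realDeriv (g : E → ℝ) (h : E) : E → ℝ := fun x => g (x + h) * g x

variable [Fintype E]

/-- The unnormalised eighth power of the `U³` norm of a real function. -/
def cubeSum (g : E → ℝ) : ℝ :=
  ∑ a, ∑ b, ∑ c, ∑ x, realDeriv (realDeriv (realDeriv g a) b) c x

lemma sum_sum_realDeriv (g : E → ℝ) : ∑ h, ∑ x, realDeriv g h x = (∑ x, g x) ^ 2 := by
  rw [Finset.sum_comm, sq, Finset.sum_mul_sum]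
  refine Finset.sum_congr rfl fun x _ => ?_
  exact Fintype.sum_equiv (Equiv.addLeft x) _ _ fun y => mul_comm _ _

lemma cubeSum_eq (g : E → ℝ) :
    cubeSum g = ∑ a, ∑ b, (∑ x, realDeriv (realDeriv g a) b x) ^ 2 := by
  simp only [cubeSum, sum_sum_realDeriv]

/-- Both sides are the unnormalised fourth power of the `U²` norm: the points `x, x + b, y, y + b`
form an additive quadruple. -/
lemma sum_sq_realDeriv_eq_quadSum [Module (ZMod 2) E] (g : E → ℝ) :
    ∑ b, (∑ x, realDeriv g b x) ^ 2 = quadSum g := by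
  simp only [sq, Finset.sum_mul_sum, quadSum]
  rw [Finset.sum_comm]
  refine Finset.sum_congr rfl fun x _ => ?_
  refine Fintype.sum_equiv (Equiv.addLeft x) _ _ fun h => ?_
  refine Finset.sum_congr rfl fun y _ => ?_
  have : x + (x + h) + y = y + h := by
    rw [← add_assoc, ZModModule.add_self, zero_add, add_comm]
  simp only [realDeriv, Equiv.coe_addLeft, this]
  ring

/-- Monotonicity of Gowers norms, by iterated Cauchy–Schwarz. For an indicator function it counts
the cubes inside a dense set. -/
lemma sum_pow_eight_le_cubeSum (g : E → ℝ) :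
    (∑ x, g x) ^ 8 ≤ (Fintype.card E : ℝ) ^ 4 * cubeSum g := by
  have cs : ∀ f : E → ℝ, (∑ x, f x) ^ 2 ≤ Fintype.card E * ∑ x, f x ^ 2 := fun f =>
    sq_sum_le_card_mul_sum_sq
  have h2 : ∀ f : E → ℝ, (∑ x, f x) ^ 4 ≤ Fintype.card E * ∑ b, (∑ x, realDeriv f b x) ^ 2 := by
    intro f
    have := cs fun b => ∑ x, realDeriv f b x
    rw [sum_sum_realDeriv] at this
    calc _ = ((∑ x, f x) ^ 2) ^ 2 := by ring
      _ ≤ _ := this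
  have h3 : (∑ a, (∑ x, realDeriv g a x) ^ 2) ^ 2
      ≤ (Fintype.card E : ℝ) ^ 2 * cubeSum g := by
    refine (cs _).trans ?_
    rw [sq (Fintype.card E : ℝ), mul_assoc]
    refine mul_le_mul_of_nonneg_left ?_ (Nat.cast_nonneg _)
    rw [cubeSum_eq, Finset.mul_sum]
    refine Finset.sum_le_sum fun a _ => ?_
    calc _ = (∑ x, realDeriv g a x) ^ 4 := by ring
      _ ≤ _ := h2 _
  calc (∑ x, g x) ^ 8 = ((∑ x, g x) ^ 4) ^ 2 := by ring
    _ ≤ (Fintype.card E * ∑ b, (∑ x, realDeriv g b x) ^ 2) ^ 2 := by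
        gcongr
        exact h2 g
    _ = (Fintype.card E : ℝ) ^ 2 * (∑ b, (∑ x, realDeriv g b x) ^ 2) ^ 2 := by ring
    _ ≤ (Fintype.card E : ℝ) ^ 2 * ((Fintype.card E : ℝ) ^ 2 * cubeSum g) := by gcongr
    _ = _ := by ring

lemma cubeSum_comp_equiv {E' : Type*} [AddCommGroup E'] [Fintype E'] (e : E' ≃+ E)
    (g : E → ℝ) : cubeSum (fun x => g (e x)) = cubeSum g := by
  simp only [cubeSum]
  refine Fintype.sum_equiv e.toEquiv _ _ fun a => ?_
  refine Fintype.sum_equiv e.toEquiv _ _ fun b => ?_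
  refine Fintype.sum_equiv e.toEquiv _ _ fun c => ?_
  refine Fintype.sum_equiv e.toEquiv _ _ fun x => ?_
  simp [realDeriv]

end Cubes

/-! ### Gowers norm and agreement in terms of real sums -/

section GowersNorm

variable {n : ℕ}

lemma sum_fin_succ_arrow {α : Type*} [Fintype α] {M : Type*} [AddCommMonoid M] (d : ℕ)
    (Φ : (Fin (d + 1) → α) → M) :
    ∑ y, Φ y = ∑ y : Fin d → α, ∑ z, Φ (Fin.snoc (α := fun _ => α) y z) := by
  rw [← (Fin.snocEquiv fun _ : Fin (d + 1) => α).sum_comp, Fintype.sum_prod_type,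
    Finset.sum_comm]
  rfl

lemma mulDeriv_ofReal (g : F2 n → ℝ) (h : F2 n) :
    mulDeriv (fun x => (g x : ℂ)) h = fun x => ((realDeriv g h x : ℝ) : ℂ) := by
  ext x
  simp [mulDeriv, realDeriv]

lemma gowersAverage_three (f : F2 n → ZMod 2) :
    gowersAverage 3 (signFun f)
      = ((cubeSum (fun x => sgn (f x)) / (Fintype.card (F2 n) : ℝ) ^ 4 : ℝ) : ℂ) := by
  have h0 : signFun f = fun x => (sgn (f x) : ℂ) := by
    ext x
    exact neg_one_pow_val _
  simp only [gowersAverage, Fintype.expect_eq_sum_div_card, ← Finset.sum_div, h0,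
    sum_fin_succ_arrow]
  simp only [iterMulDeriv, Fin.init_snoc, Fin.snoc_last, mulDeriv_ofReal, cubeSum,
    Finset.univ_unique, Finset.sum_singleton]
  push_cast
  rw [div_div]
  congr 1
  simp only [Fintype.card_fun, Fintype.card_fin, ZMod.card]
  push_cast
  ring

lemma le_gowersNorm_three_iff (f : F2 n → ZMod 2) {ε : ℝ} (hε : 0 < ε) :
    ε ≤ gowersNorm 3 (signFun f) ↔
      ε ^ 8 * (Fintype.card (F2 n) : ℝ) ^ 4 ≤ cubeSum (fun x => sgn (f x)) := by
  have hN : (0 : ℝ) < (Fintype.card (F2 n) : ℝ) ^ 4 := pow_pos card_F2_pos 4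
  have h0 : 0 ≤ cubeSum (fun x => sgn (f x)) / (Fintype.card (F2 n) : ℝ) ^ 4 := by
    refine div_nonneg ?_ hN.le
    rw [cubeSum_eq]
    exact Finset.sum_nonneg fun a _ => Finset.sum_nonneg fun b _ => sq_nonneg _
  rw [gowersNorm, gowersAverage_three, Complex.ofReal_re, ← le_div_iff₀ hN]
  have := Real.le_rpow_inv_iff_of_pos hε.le h0 (show (0 : ℝ) < 8 by norm_num)
  rw [show (1 : ℝ) / 2 ^ 3 = (8 : ℝ)⁻¹ by norm_num, this]
  norm_cast

/-- The agreement of two functions in terms of their correlation. -/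
lemma agreement_eq (f g : F2 n → ZMod 2) :
    agreement f g = 1 / 2 + (∑ x, sgn (f x + g x)) / (2 * Fintype.card (F2 n)) := by
  have hN := card_F2_pos (n := n)
  have h : ∑ x, sgn (f x + g x)
      = 2 * ((Finset.univ.filter fun x => f x = g x).card : ℝ) - Fintype.card (F2 n) := by
    have : ∀ x, sgn (f x + g x) = 2 * (if f x = g x then 1 else 0) - 1 := by
      intro x
      by_cases hx : f x = g x
      · rw [hx, ZModModule.add_self, sgn_zero, if_pos rfl]; norm_num
      · have : f x + g x ≠ 0 := fun h => hx ((add_eq_zero_iff_eq_of_two.1 h).symm)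
        rw [(zmod_two_cases _).resolve_left this, sgn_one, if_neg hx]; norm_num
    simp only [this, Finset.sum_sub_distrib, ← Finset.mul_sum, Finset.sum_boole,
      Finset.sum_const, Finset.card_univ, nsmul_eq_mul, mul_one]
  rw [h, agreement]
  field_simp
  ring

end GowersNorm

/-! ### Quadratic polynomials, alternating matrices and correlation -/

section Quadratic

variable {n : ℕ}

open MvPolynomial in
/-- The quadratic polynomial with given coefficients. -/
noncomputable def quadraticPoly (T : Matrix (Fin n) (Fin n) (ZMod 2)) (χ : F2 n) (c : ZMod 2) :
    MvPolynomial (Fin n) (ZMod 2) :=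
  ∑ i, ∑ j, C (T i j) * X j * X i + ∑ i, C (χ i) * X i + C c

lemma eval_quadraticPoly (T : Matrix (Fin n) (Fin n) (ZMod 2)) (χ : F2 n) (c : ZMod 2)
    (x : F2 n) :
    MvPolynomial.eval x (quadraticPoly T χ c) = T.mulVec x ⬝ᵥ x + χ ⬝ᵥ x + c := by
  simp [quadraticPoly, Matrix.mulVec, dotProduct, Finset.sum_mul]

lemma totalDegree_quadraticPoly_le (T : Matrix (Fin n) (Fin n) (ZMod 2)) (χ : F2 n)
    (c : ZMod 2) : (quadraticPoly T χ c).totalDegree ≤ 2 := by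
  refine (MvPolynomial.totalDegree_add _ _).trans (max_le ?_ (by simp))
  refine (MvPolynomial.totalDegree_add _ _).trans (max_le ?_ ?_)
  · refine MvPolynomial.totalDegree_finsetSum_le fun i _ =>
      MvPolynomial.totalDegree_finsetSum_le fun j _ => ?_
    refine (MvPolynomial.totalDegree_mul _ _).trans ?_
    refine (add_le_add (MvPolynomial.totalDegree_mul _ _) le_rfl).trans ?_
    simp [MvPolynomial.totalDegree_X]
  · refine MvPolynomial.totalDegree_finsetSum_le fun i _ => ?_
    refine (MvPolynomial.totalDegree_mul _ _).trans ?_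
    simp [MvPolynomial.totalDegree_X]

/-- The upper triangular part of a matrix. -/
def upperPart (M : Matrix (Fin n) (Fin n) (ZMod 2)) : Matrix (Fin n) (Fin n) (ZMod 2) :=
  Matrix.of fun i j => if i < j then M i j else 0

/-- Testing the hypothesis on basis vectors kills the diagonal; testing it on sums of two gives
symmetry. In characteristic two a quadratic form cannot be recovered by halving, so a triangular
part is used instead. -/
lemma upperPart_add_transpose {M : Matrix (Fin n) (Fin n) (ZMod 2)}
    (hM : ∀ x, M.mulVec x ⬝ᵥ x = 0) : upperPart M + (upperPart M).transpose = M := by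
  have hd : ∀ i, M i i = 0 := fun i => by simpa using hM (Pi.single i 1)
  have hs : ∀ i j, M j i = M i j := fun i j => by
    have := hM (Pi.single i 1 + Pi.single j 1)
    simp only [Matrix.mulVec_add, dotProduct_add, Matrix.mulVec_single_one, Pi.add_apply,
      dotProduct_single_one, Matrix.col_apply, hd, zero_add, add_zero] at this
    exact add_eq_zero_iff_eq_of_two.1 this
  ext i j
  simp only [upperPart, Matrix.add_apply, Matrix.of_apply, Matrix.transpose_apply]
  rcases lt_trichotomy i j with h | rfl | h
  · simp [h, h.not_gt]
  · simp [hd]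
  · simp [h, h.not_gt, hs]

/-- The polarisation identity for the quadratic form of the upper triangular part. -/
lemma upperPart_polar {M : Matrix (Fin n) (Fin n) (ZMod 2)}
    (hM : ∀ x, M.mulVec x ⬝ᵥ x = 0) (x h : F2 n) :
    (upperPart M).mulVec (x + h) ⬝ᵥ (x + h) = (upperPart M).mulVec x ⬝ᵥ x +
      (upperPart M).mulVec h ⬝ᵥ h + M.mulVec h ⬝ᵥ x := by
  conv_rhs => rw [← upperPart_add_transpose hM]
  rw [Matrix.add_mulVec, add_dotProduct, upperPart_add_transpose hM,
    Matrix.mulVec_transpose (upperPart M) h, ← Matrix.dotProduct_mulVec,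
    dotProduct_comm h ((upperPart M).mulVec x)]
  simp only [Matrix.mulVec_add, dotProduct_add, add_dotProduct]
  ring

/-- If the spectrum has large mass on the graph of an alternating matrix, then `F` correlates with
a quadratic phase. -/
lemma exists_quadratic_correlation {F : F2 n → ℝ} (hF : ∀ x, F x * F x = 1)
    {M : Matrix (Fin n) (Fin n) (ZMod 2)} (hM : ∀ x, M.mulVec x ⬝ᵥ x = 0) :
    ∃ χ : F2 n, Fintype.card (F2 n) * ∑ h, derivSpectrum F (h, M.mulVec h)
      ≤ (∑ x, F x * sgn ((upperPart M).mulVec x ⬝ᵥ x + χ ⬝ᵥ x)) ^ 2 := by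
  have hN := card_F2_pos (n := n)
  set T := upperPart M with hT
  set G : F2 n → ℝ := fun x => F x * sgn (T.mulVec x ⬝ᵥ x) with hG
  have hG2 : ∀ x, G x ^ 2 = 1 := fun x => by
    rw [hG]
    calc _ = (F x * F x) * (sgn (T.mulVec x ⬝ᵥ x) * sgn (T.mulVec x ⬝ᵥ x)) := by ring
      _ = 1 := by rw [hF, sgn_mul_self, one_mul]
  -- By polarisation, the derivative of `G` in direction `h` is that of `F` times the character `M
  -- h`, up to a sign depending only on `h`. The mass on the graph is thus the `U²` norm of `G`.
  have h1 : ∀ h, derivSpectrum F (h, M.mulVec h)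
      = (∑ x, realDeriv G h x) ^ 2 / (Fintype.card (F2 n) : ℝ) ^ 2 := by
    intro h
    have : ∑ x, realDeriv G h x
        = sgn (T.mulVec h ⬝ᵥ h) * ∑ x, F x * F (x + h) * sgn (M.mulVec h ⬝ᵥ x) := by
      rw [Finset.mul_sum]
      refine Finset.sum_congr rfl fun x _ => ?_
      simp only [realDeriv, hG, hT, upperPart_polar hM, sgn_add]
      have := sgn_mul_self ((upperPart M).mulVec x ⬝ᵥ x)
      linear_combination (F x * F (x + h) * sgn ((upperPart M).mulVec h ⬝ᵥ h) *
        sgn (M.mulVec h ⬝ᵥ x)) * this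
    rw [this, derivSpectrum, mul_pow, sq (sgn _), sgn_mul_self, one_mul, div_pow]
  have h2 : (Fintype.card (F2 n) : ℝ) * quadSum G
      = ∑ ξ, charTransform (dotPairing (Fin n)) G ξ ^ 4 :=
    (sum_charTransform_pow_four dotPairing_injective G).symm
  have h3 : ∑ ξ, charTransform (dotPairing (Fin n)) G ξ ^ 2 = (Fintype.card (F2 n) : ℝ) ^ 2 := by
    rw [sum_charTransform_sq dotPairing_injective]
    simp [hG2, sq]
  -- The fourth moment of the Fourier coefficients is at most their largest square times their
  -- second moment.
  obtain ⟨χ, -, hχ⟩ := Finset.exists_max_image Finset.univ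
    (fun ξ => charTransform (dotPairing (Fin n)) G ξ ^ 2) Finset.univ_nonempty
  refine ⟨χ, ?_⟩
  have h4 : ∑ x, F x * sgn (T.mulVec x ⬝ᵥ x + χ ⬝ᵥ x)
      = charTransform (dotPairing (Fin n)) G χ := by
    refine Finset.sum_congr rfl fun x _ => ?_
    rw [sgn_add, dotPairing_apply, dotProduct_comm χ x, hG, mul_assoc]
  rw [h4]
  simp only [h1]
  rw [← Finset.sum_div, sum_sq_realDeriv_eq_quadSum, mul_div_assoc', h2,
    div_le_iff₀ (by positivity), ← h3, Finset.mul_sum]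
  refine Finset.sum_le_sum fun ξ _ => ?_
  calc _ = charTransform (dotPairing (Fin n)) G ξ ^ 2 *
        charTransform (dotPairing (Fin n)) G ξ ^ 2 := by ring
    _ ≤ _ := mul_le_mul_of_nonneg_right (hχ ξ (Finset.mem_univ _)) (sq_nonneg _)

end Quadratic

/-! ### Graphs of linear maps over subspaces -/

section Graph

variable {V V' : Type*} [AddCommGroup V] [Module (ZMod 2) V]
  [AddCommGroup V'] [Module (ZMod 2) V']

/-- The graph of a linear map over a subspace. -/
def graphOver (R : Submodule (ZMod 2) V) (M : V →ₗ[ZMod 2] V') : Submodule (ZMod 2) (V × V') :=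
  R.map (LinearMap.id.prod M)

lemma mem_graphOver {R : Submodule (ZMod 2) V} {M : V →ₗ[ZMod 2] V'} {a : V × V'} :
    a ∈ graphOver R M ↔ a.1 ∈ R ∧ a.2 = M a.1 := by
  constructor
  · rintro ⟨h, hh, rfl⟩
    exact ⟨hh, rfl⟩
  · rintro ⟨h1, h2⟩
    exact ⟨a.1, h1, Prod.ext rfl h2.symm⟩

variable [Fintype V] [Fintype V']

open scoped Classical in
lemma sum_graphOver (R : Submodule (ZMod 2) V) (M : V →ₗ[ZMod 2] V') (g : V × V' → ℝ) :
    ∑ a with a ∈ graphOver R M, g a = ∑ h with h ∈ R, g (h, M h) := by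
  refine Finset.sum_nbij' (fun a => a.1) (fun h => (h, M h)) ?_ ?_ ?_ ?_ ?_
  · intro a ha
    simpa using (mem_graphOver.1 (Finset.mem_filter.1 ha).2).1
  · intro h hh
    simpa [mem_graphOver] using hh
  · intro a ha
    exact Prod.ext rfl (mem_graphOver.1 (Finset.mem_filter.1 ha).2).2.symm
  · intro h _
    rfl
  · intro a ha
    rw [← (mem_graphOver.1 (Finset.mem_filter.1 ha).2).2]

open scoped Classical in
lemma card_graphOver (R : Submodule (ZMod 2) V) (M : V →ₗ[ZMod 2] V') :
    (Finset.card {a | a ∈ graphOver R M} : ℝ) = (Finset.card {h | h ∈ R} : ℝ) := by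
  have := sum_graphOver R M fun _ => 1
  simpa using this

open scoped Classical in
lemma IsPosDef.card_mul_sum_submodule_le {p : V → ℝ} (hp : IsPosDef p)
    {L L' : Submodule (ZMod 2) V} (h : L ≤ L') :
    (Finset.card {a | a ∈ L} : ℝ) * ∑ a with a ∈ L', p a
      ≤ (Finset.card {a | a ∈ L'} : ℝ) * ∑ a with a ∈ L, p a := by
  have := hp.card_mul_sum_le (L := L.toAddSubgroup) (L' := L'.toAddSubgroup) h
  simpa only [Submodule.mem_toAddSubgroup] using this

end Graph

/-! ### From a subspace to a graph, and near-symmetry of its matrix -/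

section Linearise

variable {n : ℕ}

open scoped Classical in
/-- A subspace of phase space which carries much of the spectrum yields a linear map whose graph
does. -/
lemma exists_matrix_of_submodule {F : F2 n → ℝ} (hF : ∀ x, F x * F x = 1)
    (W : Submodule (ZMod 2) (F2 n × F2 n)) {ρ : ℝ} (hρ : 0 < ρ)
    (hW : ρ * (Finset.card {a | a ∈ W} : ℝ) ≤ Fintype.card (F2 n))
    (hp : ρ * Fintype.card (F2 n) ≤ ∑ a with a ∈ W, derivSpectrum F a) :
    ∃ M : Matrix (Fin n) (Fin n) (ZMod 2),
      ρ ^ 3 * Fintype.card (F2 n) ≤ ∑ h, derivSpectrum F (h, M.mulVec h) := by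
  have hN := card_F2_pos (n := n)
  have hn := derivSpectrum_nonneg F
  set R : Submodule (ZMod 2) (F2 n) := W.map (LinearMap.fst _ _ _) with hR
  have hfR : ∀ a : W, LinearMap.fst (ZMod 2) (F2 n) (F2 n) a ∈ R := fun a =>
    Submodule.mem_map_of_mem a.2
  let f : W →ₗ[ZMod 2] R := ((LinearMap.fst _ _ _).comp W.subtype).codRestrict R hfR
  -- A linear section of the projection of `W` onto `R` places a graph over `R` inside `W`; its
  -- second component is then extended to the whole space.
  obtain ⟨s, hs⟩ := f.exists_rightInverse_of_surjective (by
    rw [LinearMap.range_eq_top]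
    rintro ⟨x, a, ha, rfl⟩
    exact ⟨⟨a, ha⟩, rfl⟩)
  obtain ⟨M, hM⟩ := ((LinearMap.snd (ZMod 2) (F2 n) (F2 n)).comp
    (W.subtype.comp s)).exists_extend
  have hL : graphOver R M ≤ W := by
    intro a ha
    obtain ⟨h1, h2⟩ := mem_graphOver.1 ha
    have e1 : (s ⟨a.1, h1⟩ : F2 n × F2 n).1 = a.1 := by
      have := LinearMap.congr_fun hs ⟨a.1, h1⟩
      exact congrArg Subtype.val this
    have e2 : M a.1 = (s ⟨a.1, h1⟩ : F2 n × F2 n).2 := LinearMap.congr_fun hM ⟨a.1, h1⟩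
    have : a = s ⟨a.1, h1⟩ := Prod.ext e1.symm (h2.trans e2)
    rw [this]
    exact (s ⟨a.1, h1⟩).2
  -- Each vertical fibre has total mass one, so a subspace carrying much mass has a large
  -- projection.
  have hRc : ∑ a with a ∈ W, derivSpectrum F a ≤ (Finset.card {h | h ∈ R} : ℝ) := by
    calc ∑ a with a ∈ W, derivSpectrum F a
        ≤ ∑ a ∈ (Finset.univ.filter (· ∈ R)) ×ˢ Finset.univ, derivSpectrum F a := by
          refine Finset.sum_le_sum_of_subset_of_nonneg ?_ fun a _ _ => hn a
          intro a ha
          simpa [hR] using ⟨a.2, (Finset.mem_filter.1 ha).2⟩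
      _ = _ := by
          rw [Finset.sum_product]
          simp [sum_derivSpectrum_right hF]
  have hpos := (derivSpectrum_isPosDef F).card_mul_sum_submodule_le hL
  rw [card_graphOver, sum_graphOver] at hpos
  have hle : ∑ h with h ∈ R, derivSpectrum F (h, M h) ≤ ∑ h, derivSpectrum F (h, M h) :=
    Finset.sum_le_univ_sum_of_nonneg fun h => hn _
  refine ⟨LinearMap.toMatrix' M, ?_⟩
  simp only [LinearMap.toMatrix'_mulVec]
  have hS0 : 0 ≤ ∑ h, derivSpectrum F (h, M h) := Finset.sum_nonneg fun h _ => hn _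
  have hρN : 0 ≤ ρ * (Fintype.card (F2 n) : ℝ) := by positivity
  refine le_of_mul_le_mul_left ?_ hN
  calc (Fintype.card (F2 n) : ℝ) * (ρ ^ 3 * Fintype.card (F2 n))
      = ρ * (ρ * Fintype.card (F2 n) * (ρ * Fintype.card (F2 n))) := by ring
    _ ≤ ρ * ((Finset.card {h | h ∈ R} : ℝ) * ∑ a with a ∈ W, derivSpectrum F a) := by
        gcongr
        exact hp.trans hRc
    _ ≤ ρ * ((Finset.card {a | a ∈ W} : ℝ) * ∑ h, derivSpectrum F (h, M h)) := by
        refine mul_le_mul_of_nonneg_left (hpos.trans ?_) hρ.le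
        gcongr
    _ = (ρ * (Finset.card {a | a ∈ W} : ℝ)) * ∑ h, derivSpectrum F (h, M h) := by ring
    _ ≤ _ := by gcongr

-- Cauchy–Schwarz in `u` removes the first weight. On expanding the square, the sum over `u` is a
-- nonnegative character sum, so the remaining weights can be replaced by one; it is nonzero only
-- when `v + w` lies in the radical.
open scoped Classical in
lemma sum_sum_sgn_sq_le {a : F2 n → ℝ} (ha : ∀ u, a u ^ 2 = 1) (β : F2 n →+ F2 n →+ ZMod 2)
    (hβ : ∀ u v, β u v = β v u) :
    (∑ u, ∑ v, a u * a v * sgn (β u v)) ^ 2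
      ≤ (Fintype.card (F2 n) : ℝ) ^ 3 * (Finset.card {u | β u = 0} : ℝ) := by
  have h1 : ∀ u, (∑ v, a v * sgn (β u v)) ^ 2
      = ∑ v, ∑ w, a v * a w * sgn (β (v + w) u) := by
    intro u
    rw [sq, Finset.sum_mul_sum]
    refine Finset.sum_congr rfl fun v _ => Finset.sum_congr rfl fun w _ => ?_
    rw [hβ (v + w) u, map_add, sgn_add]
    ring
  have ha1 : ∀ u, |a u| = 1 := fun u => by
    rw [← sq_eq_sq₀ (abs_nonneg _) zero_le_one, sq_abs, ha, one_pow]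
  have h2 : ∑ u, (∑ v, a v * sgn (β u v)) ^ 2
      ≤ (Fintype.card (F2 n) : ℝ) ^ 2 * (Finset.card {u | β u = 0} : ℝ) := by
    simp only [h1]
    rw [Finset.sum_comm]
    calc _ = ∑ v, ∑ w, a v * a w * ∑ u, sgn (β (v + w) u) := by
          refine Finset.sum_congr rfl fun v _ => ?_
          rw [Finset.sum_comm]
          simp only [Finset.mul_sum]
      _ ≤ ∑ v, ∑ w, ∑ u, sgn (β (v + w) u) := by
          refine Finset.sum_le_sum fun v _ => Finset.sum_le_sum fun w _ => ?_
          refine mul_le_of_le_one_left (sum_sgn_nonneg _) ((le_abs_self _).trans ?_)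
          rw [abs_mul, ha1, ha1, one_mul]
      _ = ∑ v, ∑ w, ∑ u, sgn (β w u) := by
          refine Finset.sum_congr rfl fun v _ => ?_
          exact Fintype.sum_equiv (Equiv.addLeft v) _ _ fun w => rfl
      _ = _ := by
          simp only [sum_sgn, Finset.sum_const, Finset.card_univ, nsmul_eq_mul]
          rw [Finset.sum_ite, Finset.sum_const_zero, add_zero, Finset.sum_const, nsmul_eq_mul,
            mul_left_comm, ← sq, mul_comm]
  have h3 : ∑ u, ∑ v, a u * a v * sgn (β u v) = ∑ u, a u * ∑ v, a v * sgn (β u v) := by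
    simp only [Finset.mul_sum, mul_assoc]
  rw [h3]
  refine (Finset.sum_mul_sq_le_sq_mul_sq _ _ _).trans ?_
  simp only [ha, Finset.sum_const, Finset.card_univ, nsmul_eq_mul, mul_one]
  calc _ ≤ (Fintype.card (F2 n) : ℝ) * ((Fintype.card (F2 n) : ℝ) ^ 2 *
        (Finset.card {u | β u = 0} : ℝ)) := by gcongr
    _ = _ := by ring

/-- The symmetrisation of the bilinear form of a matrix. -/
def symmForm (M : Matrix (Fin n) (Fin n) (ZMod 2)) : F2 n →+ F2 n →+ ZMod 2 :=
  AddMonoidHom.mk' (fun u => AddMonoidHom.mk' (fun v => M.mulVec u ⬝ᵥ v + M.mulVec v ⬝ᵥ u)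
      fun v w => by simp only [Matrix.mulVec_add, dotProduct_add, add_dotProduct]; ring)
    fun u v => by
      refine AddMonoidHom.ext fun w => ?_
      simp only [Matrix.mulVec_add, dotProduct_add, add_dotProduct, AddMonoidHom.mk'_apply,
        AddMonoidHom.add_apply]
      ring

lemma symmForm_apply (M : Matrix (Fin n) (Fin n) (ZMod 2)) (u v : F2 n) :
    symmForm M u v = M.mulVec u ⬝ᵥ v + M.mulVec v ⬝ᵥ u := rfl

lemma symmForm_symm (M : Matrix (Fin n) (Fin n) (ZMod 2)) (u v : F2 n) :
    symmForm M u v = symmForm M v u := add_comm _ _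

open scoped Classical in
/-- If the graph of `M` carries much of the spectrum, then `M` is symmetric up to low rank. -/
lemma sum_graph_sq_le {F : F2 n → ℝ} (hF : ∀ x, F x * F x = 1)
    (M : Matrix (Fin n) (Fin n) (ZMod 2)) :
    (∑ h, derivSpectrum F (h, M.mulVec h)) ^ 2
      ≤ Fintype.card (F2 n) * (Finset.card {u | symmForm M u = 0} : ℝ) := by
  have hN := card_F2_pos (n := n)
  set b : F2 n → F2 n → ZMod 2 := fun u v => M.mulVec u ⬝ᵥ v with hb
  have badd : ∀ u v w, b (u + v) w = b u w + b v w := fun u v w => by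
    simp only [hb, Matrix.mulVec_add, add_dotProduct]
  have badd' : ∀ u v w, b u (v + w) = b u v + b u w := fun u v w => dotProduct_add _ _ _
  let a : F2 n → F2 n → ℝ := fun m u => F u * F (u + m) * sgn (b u u + b u m)
  have ha : ∀ m u, a m u ^ 2 = 1 := by
    intro m u
    calc a m u ^ 2 = (F u * F u) * (F (u + m) * F (u + m)) *
          (sgn (b u u + b u m) * sgn (b u u + b u m)) := by ring
      _ = 1 := by rw [hF, hF, sgn_mul_self]; norm_num
  have key : ∑ h, derivSpectrum F (h, M.mulVec h)
      = (∑ m, ∑ u, ∑ v, a m u * a m v * sgn (symmForm M u v)) /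
        (Fintype.card (F2 n) : ℝ) ^ 2 := by
    simp only [derivSpectrum_eq]
    rw [← Finset.sum_div]
    congr 1
    calc ∑ h, ∑ x, ∑ y, F x * F (x + h) * (F y * F (y + h)) * sgn (M.mulVec h ⬝ᵥ (x + y))
        = ∑ x, ∑ h, ∑ y, F x * F (x + h) * (F y * F (y + h)) * sgn (b h (x + y)) :=
          Finset.sum_comm
      _ = ∑ u, ∑ v, ∑ m, a m u * a m v * sgn (symmForm M u v) := by
          -- The substitution is `u = x`, `v = x + h`, `m = x + y + h`, so that `y = v + m` and `y +
          -- h = u + m`. The phase `b h (x + y)` then splits into a function of `(u, m)`, a function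
          -- of `(v, m)` and the symmetrised form at `(u, v)`.
          refine Finset.sum_congr rfl fun u _ => ?_
          refine Fintype.sum_equiv (Equiv.addLeft u) _ _ fun h => ?_
          refine Fintype.sum_equiv (Equiv.addLeft (u + h)) _ _ fun y => ?_
          simp only [Equiv.coe_addLeft, a]
          have e1 : u + (u + h + y) = y + h := by
            rw [← add_assoc, ← add_assoc, F2.add_self, zero_add, add_comm]
          have e2 : u + h + (u + h + y) = y := by
            rw [← add_assoc, F2.add_self, zero_add]
          rw [e1, e2]
          have e3 : sgn (b h (u + y)) = sgn (b u u + b u (u + h + y)) *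
              sgn (b (u + h) (u + h) + b (u + h) (u + h + y)) * sgn (symmForm M u (u + h)) := by
            rw [← sgn_add, ← sgn_add, symmForm_apply]
            change _ = sgn (_ + (b u (u + h) + b (u + h) u))
            congr 1
            simp only [badd, badd']
            have two : (2 : ZMod 2) = 0 := by decide
            linear_combination (-(3 * b u u + 2 * b u h + b h u + b u y + b h h)) * two
          rw [e3]
          ring
      _ = ∑ u, ∑ m, ∑ v, a m u * a m v * sgn (symmForm M u v) :=
          Finset.sum_congr rfl fun u _ => Finset.sum_comm
      _ = _ := Finset.sum_comm
  have hsq := (sq_sum_le_card_mul_sum_sq (s := Finset.univ)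
    (f := fun m => ∑ u, ∑ v, a m u * a m v * sgn (symmForm M u v))).trans
    (mul_le_mul_of_nonneg_left (Finset.sum_le_sum fun m _ =>
      sum_sum_sgn_sq_le (ha m) (symmForm M) (symmForm_symm M)) (Nat.cast_nonneg _))
  rw [key, div_pow, div_le_iff₀ (by positivity)]
  refine hsq.trans (le_of_eq ?_)
  simp only [Finset.sum_const, Finset.card_univ, nsmul_eq_mul]
  ring

end Linearise

/-! ### From a nearly symmetric matrix to an alternating one -/

section Alternate

variable {n : ℕ}

/-- The part of the radical of the symmetrised form on which the quadratic form vanishes. -/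
def isotropicRadical (M : Matrix (Fin n) (Fin n) (ZMod 2)) : Submodule (ZMod 2) (F2 n) :=
  AddSubgroup.toZModSubmodule 2
    { carrier := {u | symmForm M u = 0 ∧ M.mulVec u ⬝ᵥ u = 0}
      zero_mem' := by simp
      add_mem' := by
        rintro u v ⟨hu, hu'⟩ ⟨hv, hv'⟩
        refine ⟨by rw [map_add, hu, hv, add_zero], ?_⟩
        have h : M.mulVec u ⬝ᵥ v + M.mulVec v ⬝ᵥ u = 0 := DFunLike.congr_fun hu v
        simp only [Matrix.mulVec_add, dotProduct_add, add_dotProduct]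
        linear_combination hu' + hv' + h
      neg_mem' := by
        intro u hu
        rwa [ZModModule.neg_eq_self] }

lemma mem_isotropicRadical {M : Matrix (Fin n) (Fin n) (ZMod 2)} {u : F2 n} :
    u ∈ isotropicRadical M ↔ symmForm M u = 0 ∧ M.mulVec u ⬝ᵥ u = 0 := Iff.rfl

-- On the radical the quadratic form is additive, since its polarisation vanishes there. Its zero
-- set therefore has index at most two, and translation by any `w` of value one matches the two
-- classes.
open scoped Classical in
lemma card_radical_le (M : Matrix (Fin n) (Fin n) (ZMod 2)) :
    Finset.card {u | symmForm M u = 0} ≤ 2 * Finset.card {u | u ∈ isotropicRadical M} := by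
  by_cases h : ∃ w, symmForm M w = 0 ∧ M.mulVec w ⬝ᵥ w ≠ 0
  · obtain ⟨w, hw, hw1⟩ := h
    have hw1 := (zmod_two_cases _).resolve_left hw1
    have h1 : (Finset.univ.filter fun u => symmForm M u = 0 ∧ ¬ u ∈ isotropicRadical M).card
        ≤ Finset.card {u | u ∈ isotropicRadical M} := by
      refine Finset.card_le_card_of_injOn (fun u => u + w) (fun u hu => ?_)
        ((add_left_injective w).injOn)
      obtain ⟨-, h1, h2⟩ := Finset.mem_filter.1 (Finset.mem_coe.1 hu)
      have h3 : M.mulVec u ⬝ᵥ u = 1 :=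
        (zmod_two_cases _).resolve_left fun h => h2 (mem_isotropicRadical.2 ⟨h1, h⟩)
      refine Finset.mem_coe.2 (Finset.mem_filter.2 ⟨Finset.mem_univ _,
        mem_isotropicRadical.2 ⟨by rw [map_add, h1, hw, add_zero], ?_⟩⟩)
      have h4 : M.mulVec u ⬝ᵥ w + M.mulVec w ⬝ᵥ u = 0 := DFunLike.congr_fun h1 w
      have two : (2 : ZMod 2) = 0 := by decide
      simp only [Matrix.mulVec_add, dotProduct_add, add_dotProduct]
      linear_combination h3 + hw1 + h4 + two
    have h2 := Finset.card_filter_add_card_filter_not (s := Finset.univ.filter fun u => symmForm M u = 0)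
      (fun u => u ∈ isotropicRadical M)
    rw [Finset.filter_filter, Finset.filter_filter] at h2
    have h3 : (Finset.univ.filter fun u => symmForm M u = 0 ∧ u ∈ isotropicRadical M).card
        ≤ Finset.card {u | u ∈ isotropicRadical M} :=
      Finset.card_le_card fun u hu => by
        simpa using (Finset.mem_filter.1 hu).2.2
    omega
  · push Not at h
    have : Finset.card {u | symmForm M u = 0} ≤ Finset.card {u | u ∈ isotropicRadical M} :=
      Finset.card_le_card fun u hu => by
        have hu := (Finset.mem_filter.1 hu).2
        simpa using mem_isotropicRadical.2 ⟨hu, h u hu⟩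
    omega

/-- The subspace of pairs `(h, c)` with `c + M h` orthogonal to `U`. -/
def orthThickening (U : Submodule (ZMod 2) (F2 n)) (M : Matrix (Fin n) (Fin n) (ZMod 2)) :
    Submodule (ZMod 2) (F2 n × F2 n) :=
  AddSubgroup.toZModSubmodule 2
    { carrier := {a | ∀ t ∈ U, (a.2 + M.mulVec a.1) ⬝ᵥ t = 0}
      zero_mem' := by simp
      add_mem' := by
        intro a b ha hb t ht
        have h1 := ha t ht
        have h2 := hb t ht
        simp only [add_dotProduct, Prod.snd_add, Prod.fst_add, Matrix.mulVec_add] at h1 h2 ⊢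
        linear_combination h1 + h2
      neg_mem' := by
        intro a ha
        rwa [ZModModule.neg_eq_self] }

lemma mem_orthThickening {U : Submodule (ZMod 2) (F2 n)} {M : Matrix (Fin n) (Fin n) (ZMod 2)}
    {a : F2 n × F2 n} :
    a ∈ orthThickening U M ↔ ∀ t ∈ U, (a.2 + M.mulVec a.1) ⬝ᵥ t = 0 := Iff.rfl

-- The sum over `t ∈ U` of the signs of `(c + M h) · t` equals `|U|` on the thickening and is
-- nonnegative elsewhere; summed over all pairs `(h, c)`, only `t = 0` survives.
open scoped Classical in
lemma card_orthThickening_mul_le (U : Submodule (ZMod 2) (F2 n))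
    (M : Matrix (Fin n) (Fin n) (ZMod 2)) :
    (Finset.card {a | a ∈ orthThickening U M} : ℝ) * (Finset.card {u | u ∈ U} : ℝ)
      ≤ (Fintype.card (F2 n) : ℝ) ^ 2 := by
  have hchar : ∀ a : F2 n × F2 n,
      0 ≤ ∑ t with t ∈ U, sgn ((a.2 + M.mulVec a.1) ⬝ᵥ t) := fun a =>
    sum_sgn_subgroup_nonneg U.toAddSubgroup (dotPairing (Fin n) (a.2 + M.mulVec a.1))
  have htot : ∑ a : F2 n × F2 n, ∑ t with t ∈ U, sgn ((a.2 + M.mulVec a.1) ⬝ᵥ t)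
      = (Fintype.card (F2 n) : ℝ) ^ 2 := by
    have h1 : ∀ t : F2 n, ∑ a : F2 n × F2 n, sgn ((a.2 + M.mulVec a.1) ⬝ᵥ t)
        = if t = 0 then (Fintype.card (F2 n) : ℝ) ^ 2 else 0 := by
      intro t
      rw [Fintype.sum_prod_type]
      have : ∀ h : F2 n, ∑ c : F2 n, sgn ((c + M.mulVec h) ⬝ᵥ t)
          = if t = 0 then (Fintype.card (F2 n) : ℝ) else 0 := by
        intro h
        rw [← sum_sgn_dot_right t]
        exact Fintype.sum_equiv (Equiv.addRight (M.mulVec h)) _ _ fun c => rfl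
      simp only [this, Finset.sum_const, Finset.card_univ, nsmul_eq_mul]
      split_ifs <;> ring
    rw [Finset.sum_comm]
    simp only [h1]
    rw [Finset.sum_ite_eq' _ (0 : F2 n), if_pos (by simp)]
  rw [← htot]
  calc _ = ∑ a with a ∈ orthThickening U M, ∑ t with t ∈ U,
        sgn ((a.2 + M.mulVec a.1) ⬝ᵥ t) := by
        have : ∀ a ∈ Finset.univ.filter (· ∈ orthThickening U M), ∑ t with t ∈ U,
            sgn ((a.2 + M.mulVec a.1) ⬝ᵥ t) = (Finset.card {u | u ∈ U} : ℝ) := by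
          intro a ha
          have ha := mem_orthThickening.1 (Finset.mem_filter.1 ha).2
          rw [Finset.sum_congr rfl fun t ht => by rw [ha t (Finset.mem_filter.1 ht).2, sgn_zero]]
          simp
        rw [Finset.sum_congr rfl this, Finset.sum_const, nsmul_eq_mul]
    _ ≤ _ := Finset.sum_le_univ_sum_of_nonneg hchar

/-- If the graph of a matrix carries much of the spectrum, so does that of an alternating one. -/
lemma exists_alternating {F : F2 n → ℝ} (hF : ∀ x, F x * F x = 1)
    (M : Matrix (Fin n) (Fin n) (ZMod 2)) {σ : ℝ} (hσ : 0 < σ)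
    (hM : σ * Fintype.card (F2 n) ≤ ∑ h, derivSpectrum F (h, M.mulVec h)) :
    ∃ M' : Matrix (Fin n) (Fin n) (ZMod 2), (∀ x, M'.mulVec x ⬝ᵥ x = 0) ∧
      σ ^ 5 / 4 * Fintype.card (F2 n) ≤ ∑ h, derivSpectrum F (h, M'.mulVec h) := by
  classical
  have hN := card_F2_pos (n := n)
  have hpd := derivSpectrum_isPosDef F
  set U := isotropicRadical M with hU
  have hUcard : σ ^ 2 / 2 * Fintype.card (F2 n) ≤ (Finset.card {u | u ∈ U} : ℝ) := by
    have h1 := (pow_le_pow_left₀ (by positivity) hM 2).trans (sum_graph_sq_le hF M)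
    have h2 : (Finset.card {u | symmForm M u = 0} : ℝ)
        ≤ 2 * (Finset.card {u | u ∈ U} : ℝ) := by
      exact_mod_cast card_radical_le M
    refine le_of_mul_le_mul_left ?_ hN
    nlinarith [mul_le_mul_of_nonneg_left h2 hN.le]
  obtain ⟨g, hg⟩ := U.subtype.exists_leftInverse_of_injective U.ker_subtype
  have hgU : ∀ u (hu : u ∈ U), (g u : F2 n) = u := fun u hu =>
    congrArg Subtype.val (LinearMap.congr_fun hg ⟨u, hu⟩)
  -- `P` projects onto `U`. The form of `Pᵀ M P` is that of `M` pulled back along `P`: it agrees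
  -- with `M` on `U` and is alternating everywhere, because the quadratic form of `M` vanishes on
  -- `U`.
  let P : Matrix (Fin n) (Fin n) (ZMod 2) := LinearMap.toMatrix' (U.subtype.comp g)
  have hP : ∀ x, P.mulVec x = (g x : F2 n) := fun x => LinearMap.toMatrix'_mulVec _ _
  have hform : ∀ x y : F2 n, (P.transpose * M * P).mulVec x ⬝ᵥ y
      = M.mulVec (g x : F2 n) ⬝ᵥ (g y : F2 n) := by
    intro x y
    rw [← hP, ← hP, ← Matrix.mulVec_mulVec, ← Matrix.mulVec_mulVec, Matrix.mulVec_transpose,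
      ← Matrix.dotProduct_mulVec]
  refine ⟨P.transpose * M * P, fun x => ?_, ?_⟩
  · rw [hform]
    exact (mem_isotropicRadical.1 (g x).2).2
  set M' := P.transpose * M * P with hM'
  have s1 : (Finset.card {u | u ∈ U} : ℝ) * ∑ h, derivSpectrum F (h, M.mulVec h)
      ≤ Fintype.card (F2 n) * ∑ h with h ∈ U, derivSpectrum F (h, M.mulVec h) := by
    have := hpd.card_mul_sum_submodule_le
      (L := graphOver U (Matrix.toLin' M)) (L' := graphOver ⊤ (Matrix.toLin' M))
      fun a ha => mem_graphOver.2 ⟨trivial, (mem_graphOver.1 ha).2⟩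
    simpa only [card_graphOver, sum_graphOver, Submodule.mem_top, Finset.filter_true,
      Finset.card_univ, Matrix.toLin'_apply] using this
  -- The thickening contains both the graph of `M` over `U` and the full graph of `M'`, and so links
  -- the two by monotonicity of averages.
  have hUW : graphOver U (Matrix.toLin' M) ≤ orthThickening U M' := by
    intro a ha t ht
    obtain ⟨h1, h2⟩ := mem_graphOver.1 ha
    rw [h2, add_dotProduct, hform, hgU _ h1, hgU _ ht, Matrix.toLin'_apply, ZModModule.add_self]
  have s2 : ∑ h with h ∈ U, derivSpectrum F (h, M.mulVec h)
      ≤ ∑ a with a ∈ orthThickening U M', derivSpectrum F a := by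
    have : ∑ h with h ∈ U, derivSpectrum F (h, M.mulVec h)
        = ∑ a with a ∈ graphOver U (Matrix.toLin' M), derivSpectrum F a := by
      rw [sum_graphOver]
      simp only [Matrix.toLin'_apply]
    rw [this]
    refine Finset.sum_le_sum_of_subset_of_nonneg (fun a ha => ?_)
      fun a _ _ => derivSpectrum_nonneg F a
    simpa using hUW (Finset.mem_filter.1 ha).2
  have s3 : (Fintype.card (F2 n) : ℝ) * ∑ a with a ∈ orthThickening U M', derivSpectrum F a
      ≤ (Finset.card {a | a ∈ orthThickening U M'} : ℝ) *
        ∑ h, derivSpectrum F (h, M'.mulVec h) := by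
    have := hpd.card_mul_sum_submodule_le
      (L := graphOver ⊤ (Matrix.toLin' M')) (L' := orthThickening U M') (by
        intro a ha t _
        rw [(mem_graphOver.1 ha).2, Matrix.toLin'_apply, ZModModule.add_self, zero_dotProduct])
    simpa only [card_graphOver, sum_graphOver, Submodule.mem_top, Finset.filter_true,
      Finset.card_univ, Matrix.toLin'_apply] using this
  have s4 := card_orthThickening_mul_le U M'
  set N := (Fintype.card (F2 n) : ℝ)
  set u := (Finset.card {u | u ∈ U} : ℝ)
  set X := ∑ h, derivSpectrum F (h, M'.mulVec h)
  set Y := ∑ h, derivSpectrum F (h, M.mulVec h)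
  set Z := ∑ h with h ∈ U, derivSpectrum F (h, M.mulVec h)
  set Q := ∑ a with a ∈ orthThickening U M', derivSpectrum F a
  have hX : 0 ≤ X := Finset.sum_nonneg fun h _ => derivSpectrum_nonneg F _
  have hu : 0 ≤ u := Nat.cast_nonneg _
  have t1 : u * Y ≤ N * Q := s1.trans (mul_le_mul_of_nonneg_left s2 hN.le)
  have t2 : u * (u * Y) ≤ N ^ 2 * X := by
    calc u * (u * Y) ≤ u * (N * Q) := by gcongr
      _ ≤ u * (_ * X) := by gcongr
      _ = (_ * u) * X := by rw [← mul_assoc, mul_comm u]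
      _ ≤ _ := by gcongr
  have t3 : (σ ^ 2 / 2 * N) * ((σ ^ 2 / 2 * N) * (σ * N)) ≤ u * (u * Y) := by gcongr
  have t4 : N ^ 2 * (σ ^ 5 / 4 * N) ≤ N ^ 2 * X := by
    refine le_trans (le_of_eq ?_) (t3.trans t2)
    ring
  exact le_of_mul_le_mul_left t4 (by positivity)

end Alternate

/-! ### Freiman–Ruzsa implies inverse Gowers -/

section Forward

/-- The polynomial Freiman–Ruzsa conjecture in an arbitrary finite space over `𝔽₂`. -/
lemma PolynomialFreimanRuzsa.exists_span_le (h : PolynomialFreimanRuzsa) :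
    ∃ C : ℕ, 0 < C ∧ ∀ (E : Type) [AddCommGroup E] [Module (ZMod 2) E] [Fintype E]
      [DecidableEq E] (S : Finset E) (K : ℝ), S.Nonempty →
      ((S + S).card : ℝ) ≤ K * (S.card : ℝ) →
      ∃ S' : Finset E, S' ⊆ S ∧ (S.card : ℝ) / (C * K ^ C) ≤ (S'.card : ℝ) ∧
        (Nat.card (Submodule.span (ZMod 2) (S' : Set E)) : ℝ) ≤ C * K ^ C * (S.card : ℝ) := by
  obtain ⟨C, hC, h⟩ := h
  refine ⟨C, hC, fun E _ _ _ _ S K hS hK => ?_⟩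
  let e : E ≃ₗ[ZMod 2] F2 (Module.finrank (ZMod 2) E) := (Module.finBasis (ZMod 2) E).equivFun
  have hcard : ∀ T : Finset E, (T.image e).card = T.card := fun T =>
    Finset.card_image_of_injective T e.injective
  obtain ⟨T, hTS, hT1, hT2⟩ := h _ (S.image e) K (hS.image e) (by
    rw [← Finset.image_add, hcard, hcard]
    exact hK)
  have hT : (T.image e.symm).image e = T := by
    rw [Finset.image_image]
    simp [Function.comp_def]
  refine ⟨T.image e.symm, ?_, ?_, ?_⟩
  · intro x hx
    obtain ⟨y, hy, rfl⟩ := Finset.mem_image.1 hx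
    obtain ⟨z, hz, rfl⟩ := Finset.mem_image.1 (hTS hy)
    simpa using hz
  · rw [hcard] at hT1
    rwa [← hcard (T.image e.symm), hT]
  · rw [hcard] at hT2
    refine le_trans (le_of_eq ?_) hT2
    congr 1
    have : Submodule.span (ZMod 2) (T : Set _)
        = (Submodule.span (ZMod 2) ((T.image e.symm : Finset E) : Set E)).map
          e.toLinearMap := by
      rw [Submodule.map_span, LinearEquiv.coe_coe, ← Finset.coe_image, hT]
    rw [this]
    exact Nat.card_congr (e.submoduleMap _).toEquiv

variable {n : ℕ}

open scoped Classical in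
/-- Under the polynomial Freiman–Ruzsa conjecture, a function with spectrum of large fourth moment
has a small subspace of phase space which carries much of its spectrum. -/
lemma exists_submodule_of_fourth_moment (h : PolynomialFreimanRuzsa) :
    ∃ C : ℕ, 0 < C ∧ ∀ (n : ℕ) (F : F2 n → ℝ), (∀ x, F x * F x = 1) → ∀ η : ℝ, 0 < η → η ≤ 1 / 8 →
      8 * η * Fintype.card (F2 n) ≤ ∑ a, derivSpectrum F a ^ 4 →
      ∃ W : Submodule (ZMod 2) (F2 n × F2 n),
        η ^ (6 + 40 * C) / (C * 4 ^ C) * (Finset.card {a | a ∈ W} : ℝ) ≤ Fintype.card (F2 n) ∧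
        η ^ (6 + 40 * C) / (C * 4 ^ C) * Fintype.card (F2 n) ≤
          ∑ a with a ∈ W, derivSpectrum F a := by
  obtain ⟨C, hC, h⟩ := h.exists_span_le
  refine ⟨C, hC, fun n F hF η hη hη8 hp4 => ?_⟩
  have hN := card_F2_pos (n := n)
  set p := derivSpectrum F with hp
  have hp0 : ∀ a, 0 ≤ p a := derivSpectrum_nonneg F
  set N : ℝ := (Fintype.card (F2 n) : ℝ) with hNdef
  set A : Finset (F2 n × F2 n) := Finset.univ.filter fun a => η ≤ p a with hA
  have hsum : ∑ a, p a = N := sum_derivSpectrum hF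
  -- The energy of the spectrum is at least `8 η N³`, of which quadruples leaving `A` account for at
  -- most `4 η N³`.
  have hquad : 4 * η * N ^ 3 ≤ quadCount A := by
    have h1 := quadSum_le_quadCount_add hp0 (derivSpectrum_le_one hF) hη.le
      (A := A) fun a ha => by
        by_contra hc
        exact ha (Finset.mem_filter.2 ⟨Finset.mem_univ _, (not_le.1 hc).le⟩)
    rw [hp, quadSum_derivSpectrum, ← hp, hsum] at h1
    have h2 : N ^ 2 * (8 * η * N) ≤ N ^ 2 * ∑ a, p a ^ 4 := by gcongr
    nlinarith
  have hquad' : quadCount A ≤ (A.card : ℝ) ^ 3 := by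
    rw [quadCount_eq]
    calc _ ≤ ∑ a ∈ A, ∑ b ∈ A, (A.card : ℝ) := Finset.sum_le_sum fun a _ =>
          Finset.sum_le_sum fun b _ => Nat.cast_le.2 (Finset.card_filter_le A _)
      _ = _ := by simp only [Finset.sum_const, nsmul_eq_mul]; ring
  have hAη : η * A.card ≤ N := by
    rw [← hsum, mul_comm, ← nsmul_eq_mul, ← Finset.sum_const]
    exact (Finset.sum_le_sum fun a ha => (Finset.mem_filter.1 ha).2).trans
      (Finset.sum_le_univ_sum_of_nonneg hp0)
  have hAN : 4 * η * N ≤ A.card := by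
    refine le_of_pow_le_pow_left₀ three_ne_zero (Nat.cast_nonneg _) ?_
    refine le_trans ?_ (hquad.trans hquad')
    have : (4 * η) ^ 3 ≤ 4 * η := by
      have h4 : 4 * η ≤ 1 := by linarith
      exact pow_le_of_le_one (by positivity) h4 three_ne_zero
    calc (4 * η * N) ^ 3 = (4 * η) ^ 3 * N ^ 3 := by ring
      _ ≤ 4 * η * N ^ 3 := by gcongr
  have hA0 : A.Nonempty := by
    rw [← Finset.card_pos, ← Nat.cast_pos (α := ℝ)]
    exact lt_of_lt_of_le (by positivity) hAN
  -- Since `η |A| ≤ N`, the `4 η N³` quadruples are at least `4 η⁴ |A|³`, whence `δ = 2 η⁴`. The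
  -- resulting doubling constant is `4 / η⁴⁰`.
  obtain ⟨A', hA'A, hA'card, hA'⟩ := balog_szemeredi_gowers A hA0
    (δ := 2 * η ^ 4) (by positivity) (by
      refine le_trans ?_ hquad
      calc 2 * (2 * η ^ 4) * (A.card : ℝ) ^ 3 = 4 * η * (η * A.card) ^ 3 := by ring
        _ ≤ _ := by gcongr)
  have hA'N : 2 * η ^ 5 * N ≤ A'.card := by
    refine le_trans ?_ hA'card
    calc 2 * η ^ 5 * N = 2 * η ^ 4 / 4 * (4 * η * N) := by ring
      _ ≤ _ := by gcongr
  have hA'0 : A'.Nonempty := by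
    rw [← Finset.card_pos, ← Nat.cast_pos (α := ℝ)]
    exact lt_of_lt_of_le (by positivity) hA'N
  have hA'le : η * A'.card ≤ N := le_trans (by gcongr) hAη
  obtain ⟨S, hSA', hS1, hS2⟩ := h _ A' (4096 / (2 * η ^ 4) ^ 10) hA'0 hA'
  have hK : (4096 / (2 * η ^ 4) ^ 10 : ℝ) ^ C = 4 ^ C / η ^ (40 * C) := by
    rw [mul_pow, ← pow_mul, div_mul_eq_div_div, pow_mul η 40 C, ← div_pow]
    norm_num
  rw [hK] at hS1 hS2
  have hC' : (0 : ℝ) < C := by exact_mod_cast hC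
  set W := Submodule.span (ZMod 2) (S : Set (F2 n × F2 n)) with hW
  have hη1 : η ≤ 1 := by linarith
  have hD : (0 : ℝ) < C * 4 ^ C := by positivity
  have hWcard : (Nat.card W : ℝ) = (Finset.card {a | a ∈ W} : ℝ) := by
    rw [Nat.card_eq_fintype_card, Fintype.card_subtype]
  rw [hWcard] at hS2
  refine ⟨W, ?_, ?_⟩
  · rw [div_mul_eq_mul_div, div_le_iff₀ hD]
    calc η ^ (6 + 40 * C) * (Finset.card {a | a ∈ W} : ℝ)
        ≤ η ^ (6 + 40 * C) * (C * (4 ^ C / η ^ (40 * C)) * A'.card) := by gcongr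
      _ = η ^ 5 * ((η * A'.card) * (C * 4 ^ C)) := by
          rw [pow_add]
          field_simp
      _ ≤ 1 * (N * (C * 4 ^ C)) := by
          gcongr
          exact pow_le_one₀ hη.le hη1
      _ = _ := one_mul _
  · have h1 : η * S.card ≤ ∑ a with a ∈ W, p a := by
      rw [mul_comm, ← nsmul_eq_mul, ← Finset.sum_const]
      refine (Finset.sum_le_sum fun a ha =>
        (Finset.mem_filter.1 (hA'A (hSA' ha))).2).trans ?_
      refine Finset.sum_le_sum_of_subset_of_nonneg (fun a ha => ?_) fun a _ _ => hp0 a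
      exact Finset.mem_filter.2 ⟨Finset.mem_univ _, Submodule.subset_span ha⟩
    refine le_trans ?_ h1
    have h2 : η ^ (5 + 40 * C) / (C * 4 ^ C) * N ≤ S.card := by
      refine le_trans ?_ hS1
      rw [mul_div_assoc', div_div_eq_mul_div, div_mul_eq_mul_div]
      refine div_le_div_of_nonneg_right ?_ hD.le
      have h5 : η ^ 5 * N ≤ A'.card := by
        refine le_trans ?_ hA'N
        linarith [show 0 < η ^ 5 * N by positivity]
      calc η ^ (5 + 40 * C) * N = η ^ 5 * N * η ^ (40 * C) := by rw [pow_add]; ring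
        _ ≤ _ := by gcongr
    calc _ = η * (η ^ (5 + 40 * C) / (C * 4 ^ C) * N) := by
          rw [show 6 + 40 * C = (5 + 40 * C) + 1 by ring, pow_succ]; ring
      _ ≤ _ := by gcongr

/-- The cube sum is `N³` times the second moment of the spectrum. As the total mass is `N`, Hölder
passes to the fourth moment and cubes `ε⁸`. -/
lemma fourth_moment_of_cubeSum {F : F2 n → ℝ} (hF : ∀ x, F x * F x = 1) {ε : ℝ}
    (hε : ε ^ 8 * (Fintype.card (F2 n) : ℝ) ^ 4 ≤ cubeSum F) :
    ε ^ 24 * Fintype.card (F2 n) ≤ ∑ a, derivSpectrum F a ^ 4 := by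
  have hN := card_F2_pos (n := n)
  set N : ℝ := (Fintype.card (F2 n) : ℝ)
  have h1 : ∀ h : F2 n, N ^ 3 * ∑ χ, derivSpectrum F (h, χ) ^ 2 = quadSum (realDeriv F h) := by
    intro h
    have h2 := sum_charTransform_pow_four (dotPairing_injective (ι := Fin n)) (realDeriv F h)
    apply mul_left_cancel₀ hN.ne'
    rw [← h2, Finset.mul_sum, Finset.mul_sum]
    refine Finset.sum_congr rfl fun χ _ => ?_
    have : charTransform (dotPairing (Fin n)) (realDeriv F h) χ
        = ∑ x, F x * F (x + h) * sgn (χ ⬝ᵥ x) := by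
      refine Finset.sum_congr rfl fun x _ => ?_
      rw [realDeriv, dotPairing_apply, dotProduct_comm x χ, mul_comm (F (x + h))]
    rw [this, derivSpectrum]
    change N * (N ^ 3 * (((_ / N) ^ 2) ^ 2)) = _
    field_simp
  have h2 : cubeSum F = N ^ 3 * ∑ a, derivSpectrum F a ^ 2 := by
    rw [cubeSum_eq, Fintype.sum_prod_type, Finset.mul_sum]
    refine Finset.sum_congr rfl fun h _ => ?_
    rw [h1, sum_sq_realDeriv_eq_quadSum]
  have h3 : ε ^ 8 * N ≤ ∑ a, derivSpectrum F a ^ 2 := by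
    refine le_of_mul_le_mul_left (?_ : N ^ 3 * _ ≤ N ^ 3 * _) (by positivity)
    rw [← h2]
    refine le_trans (le_of_eq ?_) hε
    ring
  have h4 := sum_sq_pow_three_le Finset.univ (derivSpectrum F) (derivSpectrum_nonneg F)
  rw [sum_derivSpectrum hF] at h4
  have h5 : (ε ^ 8 * N) ^ 3 ≤ (∑ a, derivSpectrum F a ^ 2) ^ 3 := by
    have : 0 ≤ ε ^ 8 := by positivity
    gcongr
  refine le_of_mul_le_mul_left (?_ : N ^ 2 * _ ≤ N ^ 2 * _) (by positivity)
  refine le_trans (le_of_eq ?_) (h5.trans h4)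
  ring

lemma cubeSum_le {F : F2 n → ℝ} (hF : ∀ x, F x * F x = 1) :
    cubeSum F ≤ (Fintype.card (F2 n) : ℝ) ^ 4 := by
  have key : ∀ x, F x ≤ 1 ∧ -1 ≤ F x := fun x => by
    constructor <;> nlinarith [hF x]
  have hd : ∀ (g : F2 n → ℝ) (h : F2 n), (∀ x, g x * g x = 1) →
      ∀ x, realDeriv g h x * realDeriv g h x = 1 := fun g h hg x => by
    calc _ = (g (x + h) * g (x + h)) * (g x * g x) := by simp only [realDeriv]; ring
      _ = 1 := by rw [hg, hg, one_mul]
  calc cubeSum F ≤ ∑ a : F2 n, ∑ b : F2 n, ∑ c : F2 n, ∑ x : F2 n, (1 : ℝ) := by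
        refine Finset.sum_le_sum fun a _ => Finset.sum_le_sum fun b _ =>
          Finset.sum_le_sum fun c _ => Finset.sum_le_sum fun x _ => ?_
        nlinarith [hd _ c (hd _ b (hd _ a hF)) x]
    _ = _ := by simp only [Finset.sum_const, Finset.card_univ, nsmul_eq_mul]; ring

/-- The polynomial Freiman–Ruzsa conjecture implies the polynomial inverse Gowers conjecture. -/
theorem PolynomialFreimanRuzsa.polynomialInverseGowersU3 (h : PolynomialFreimanRuzsa) :
    PolynomialInverseGowersU3 := by
  obtain ⟨C, hC, h⟩ := exists_submodule_of_fourth_moment h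
  have hC' : (0 : ℝ) < C := by exact_mod_cast hC
  set m := 6 + 40 * C with hm
  set D : ℕ := C * 4 ^ C with hD
  have hD0 : 0 < D := by positivity
  -- The final gain is `τ / 2 = ε ^ (360 m) / (8 · 8 ^ (15 m) · D ^ 15)`. One constant must dominate
  -- both exponent and denominator, so they are added.
  refine ⟨360 * m + 8 * 8 ^ (15 * m) * D ^ 15, by positivity, fun n f ε hε hf => ?_⟩
  have hN := card_F2_pos (n := n)
  set N : ℝ := (Fintype.card (F2 n) : ℝ) with hNdef
  set F : F2 n → ℝ := fun x => sgn (f x) with hFdef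
  have hF : ∀ x, F x * F x = 1 := fun x => sgn_mul_self _
  rw [le_gowersNorm_three_iff f hε] at hf
  have hε1 : ε ≤ 1 := by
    have h1 : ε ^ 8 * N ^ 4 ≤ 1 * N ^ 4 := by
      rw [one_mul]
      exact hf.trans (cubeSum_le hF)
    have h2 : ε ^ 8 ≤ 1 := le_of_mul_le_mul_right h1 (by positivity)
    exact (pow_le_one_iff_of_nonneg hε.le (by norm_num)).1 h2
  obtain ⟨W, hW1, hW2⟩ := h n F hF (ε ^ 24 / 8) (by positivity)
    (by linarith [pow_le_one₀ (n := 24) hε.le hε1])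
    (by
      rw [mul_div_cancel₀ _ (by norm_num : (8 : ℝ) ≠ 0)]
      exact fourth_moment_of_cubeSum hF hf)
  set ρ : ℝ := (ε ^ 24 / 8) ^ m / (C * 4 ^ C) with hρ
  have hρ0 : 0 < ρ := by positivity
  obtain ⟨M, hM⟩ := exists_matrix_of_submodule hF W hρ0 hW1 hW2
  obtain ⟨M', hM'0, hM'⟩ := exists_alternating hF M (by positivity) hM
  obtain ⟨χ, hχ⟩ := exists_quadratic_correlation hF hM'0
  set X : ℝ := ∑ x, F x * sgn ((upperPart M').mulVec x ⬝ᵥ x + χ ⬝ᵥ x) with hX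
  set τ : ℝ := (ρ ^ 3) ^ 5 / 4 with hτ
  have hτ0 : 0 < τ := by positivity
  have hρ1 : ρ ≤ 1 := by
    refine div_le_one_of_le₀ ?_ (by positivity)
    have h1 : (ε ^ 24 / 8) ^ m ≤ 1 := pow_le_one₀ (by positivity)
      (by linarith [pow_le_one₀ (n := 24) hε.le hε1])
    have h2 : (1 : ℝ) ≤ C * 4 ^ C := by exact_mod_cast hD0
    linarith
  have hτ1 : τ ≤ 1 := by
    have : (ρ ^ 3) ^ 5 ≤ 1 := pow_le_one₀ (by positivity) (pow_le_one₀ hρ0.le hρ1)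
    linarith
  have hXabs : τ * N ≤ |X| := by
    refine abs_le_of_sq_le_sq' ?_ (abs_nonneg _) |>.2
    rw [sq_abs]
    refine le_trans ?_ (le_trans (mul_le_mul_of_nonneg_left hM' hN.le) hχ)
    have : τ * τ ≤ τ := mul_le_of_le_one_left hτ0.le hτ1
    calc (τ * N) ^ 2 = τ * τ * (N * N) := by ring
      _ ≤ τ * (N * N) := by gcongr
      _ = _ := by ring
  -- The constant term of the polynomial turns a negative correlation into a positive one.
  obtain ⟨c, hc⟩ : ∃ c : ZMod 2, sgn c * X = |X| := by
    rcases le_total 0 X with h0 | h0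
    · exact ⟨0, by rw [sgn_zero, one_mul, abs_of_nonneg h0]⟩
    · exact ⟨1, by rw [sgn_one, abs_of_nonpos h0]; ring⟩
  refine ⟨quadraticPoly (upperPart M') χ c, totalDegree_quadraticPoly_le _ _ _, ?_⟩
  rw [agreement_eq]
  have hsum : ∑ x, sgn (f x + MvPolynomial.eval x (quadraticPoly (upperPart M') χ c)) = |X| := by
    rw [← hc, hX, Finset.mul_sum]
    refine Finset.sum_congr rfl fun x _ => ?_
    rw [eval_quadraticPoly, sgn_add, sgn_add _ c]
    ring
  rw [hsum]
  have hfin : τ / 2 ≤ |X| / (2 * N) := by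
    rw [div_le_div_iff₀ (by norm_num) (by positivity)]
    linarith
  refine add_le_add le_rfl (le_trans ?_ hfin)
  have hτeq : τ / 2 = ε ^ (360 * m) / (8 * 8 ^ (15 * m) * D ^ 15) := by
    rw [hτ, hρ, hD]
    push_cast
    rw [← pow_mul, div_pow, div_pow, div_pow, ← pow_mul, ← pow_mul, ← pow_mul]
    rw [show 24 * (m * (3 * 5)) = 360 * m by ring, show m * (3 * 5) = 15 * m by ring]
    field_simp
    ring
  rw [hτeq]
  have hB : (0 : ℝ) < 8 * 8 ^ (15 * m) * D ^ 15 := by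
    have : (0 : ℝ) < D := by exact_mod_cast hD0
    positivity
  push_cast
  refine div_le_div₀ (by positivity) (pow_le_pow_of_le_one hε.le hε1 (Nat.le_add_right _ _)) hB ?_
  have : (0 : ℝ) ≤ 360 * m := by positivity
  linarith

end Forward

/-! ### Quadratic functions without coordinates -/

section QuadraticFunctions

/-- Functions whose third derivatives at the origin vanish. -/
def IsQuadratic {E : Type*} [AddCommGroup E] (q : E → ZMod 2) : Prop :=
  ∀ x y z, q (x + y + z) + q (x + y) + q (x + z) + q (y + z) + q x + q y + q z + q 0 = 0

lemma isQuadratic_prod {n : ℕ} (s : Multiset (Fin n)) (hs : s.card ≤ 2) :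
    IsQuadratic fun x : F2 n => (s.map x).prod := by
  have two : (2 : ZMod 2) = 0 := by decide
  intro x y z
  interval_cases h : s.card
  · rw [Multiset.card_eq_zero] at h
    subst h
    simp only [Multiset.map_zero, Multiset.prod_zero]
    decide
  · obtain ⟨i, rfl⟩ := Multiset.card_eq_one.1 h
    simp only [Multiset.map_singleton, Multiset.prod_singleton, Pi.add_apply, Pi.zero_apply]
    linear_combination (2 * x i + 2 * y i + 2 * z i) * two
  · obtain ⟨i, j, rfl⟩ := Multiset.card_eq_two.1 h
    simp only [Multiset.insert_eq_cons, Multiset.map_cons, Multiset.map_singleton,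
      Multiset.prod_cons, Multiset.prod_singleton, Pi.add_apply, Pi.zero_apply]
    have key : ∀ a b c d e k : ZMod 2, (a + c + e) * (b + d + k) + (a + c) * (b + d) +
        (a + e) * (b + k) + (c + e) * (d + k) + a * b + c * d + e * k + 0 * 0 = 0 := by decide
    exact key _ _ _ _ _ _

lemma isQuadratic_eval {n : ℕ} (p : MvPolynomial (Fin n) (ZMod 2)) (hp : p.totalDegree ≤ 2) :
    IsQuadratic fun x : F2 n => MvPolynomial.eval x p := by
  intro x y z
  simp only [MvPolynomial.eval_eq', ← Finset.sum_add_distrib, ← mul_add]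
  refine Finset.sum_eq_zero fun m hm => ?_
  have hcard : m.toMultiset.card ≤ 2 := by
    rw [Finsupp.card_toMultiset]
    exact (MvPolynomial.le_totalDegree hm).trans hp
  have hprod : ∀ w : F2 n, ∏ i, w i ^ m i = (m.toMultiset.map w).prod := fun w => by
    rw [Finsupp.toMultiset_map, Finsupp.prod_toMultiset,
      Finsupp.prod_mapDomain_index (fun _ => pow_zero _) (fun _ _ _ => pow_add _ _ _),
      Finsupp.prod_fintype _ _ fun _ => pow_zero _]
  have := isQuadratic_prod m.toMultiset hcard x y z
  simp only [hprod]
  rw [this, mul_zero]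

/-- The polynomial inverse Gowers conjecture in an arbitrary finite space over `𝔽₂`. -/
lemma PolynomialInverseGowersU3.exists_isQuadratic (h : PolynomialInverseGowersU3) :
    ∃ C : ℕ, 0 < C ∧ ∀ (E : Type) [AddCommGroup E] [Module (ZMod 2) E] [Fintype E]
      (f : E → ZMod 2) (ε : ℝ), 0 < ε →
      ε ^ 8 * (Fintype.card E : ℝ) ^ 4 ≤ cubeSum (fun x => sgn (f x)) →
      ∃ q : E → ZMod 2, IsQuadratic q ∧
        2 * (ε ^ C / C) * Fintype.card E ≤ ∑ x, sgn (f x + q x) := by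
  obtain ⟨C, hC, h⟩ := h
  refine ⟨C, hC, fun E _ _ _ f ε hε hf => ?_⟩
  let e : E ≃ₗ[ZMod 2] F2 (Module.finrank (ZMod 2) E) := (Module.finBasis (ZMod 2) E).equivFun
  have hcard : Fintype.card E = Fintype.card (F2 (Module.finrank (ZMod 2) E)) :=
    Fintype.card_congr e.toEquiv
  have hN : (0 : ℝ) < Fintype.card E := by
    rw [hcard]; exact card_F2_pos
  obtain ⟨p, hp, hp2⟩ := h _ (fun x => f (e.symm x)) ε hε (by
    rw [le_gowersNorm_three_iff _ hε, ← hcard]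
    exact hf.trans (cubeSum_comp_equiv e.symm.toAddEquiv fun x => sgn (f x)).ge)
  refine ⟨fun x => MvPolynomial.eval (e x) p, fun x y z => ?_, ?_⟩
  · simp only [map_add, map_zero]
    exact isQuadratic_eval p hp _ _ _
  · have h1 : ∑ x, sgn (f x + MvPolynomial.eval (e x) p)
        = ∑ x, sgn (f (e.symm x) + MvPolynomial.eval x p) :=
      Fintype.sum_equiv e.toEquiv _ _ fun x => by simp
    rw [agreement_eq, add_le_add_iff_left, ← hcard, ← h1, le_div_iff₀ (by positivity)] at hp2
    linarith

end QuadraticFunctions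

/-! ### The `U³` norm of a bilinear phase and affine agreement -/

section BilinearPhase

variable {V : Type} [AddCommGroup V] {ι : Type} [Fintype ι]

lemma realDeriv_three {E : Type*} [AddCommGroup E] (g : E → ℝ) (a b c x : E) :
    realDeriv (realDeriv (realDeriv g a) b) c x =
      g (x + c + b + a) * g (x + c + b) * (g (x + c + a) * g (x + c)) *
      (g (x + b + a) * g (x + b) * (g (x + a) * g x)) := rfl

lemma cubeSum_prod [Fintype V] {Y : Type*} [AddCommGroup Y] [Fintype Y] (F : V × Y → ℝ) :
    cubeSum F = ∑ a, ∑ b, ∑ c, ∑ x, ∑ w : Y × Y × Y × Y,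
      realDeriv (realDeriv (realDeriv F (a, w.1)) (b, w.2.1)) (c, w.2.2.1) (x, w.2.2.2) := by
  let e : (V × Y) × (V × Y) × (V × Y) × (V × Y) ≃ (V × V × V × V) × (Y × Y × Y × Y) :=
    { toFun := fun p => ((p.1.1, p.2.1.1, p.2.2.1.1, p.2.2.2.1),
        (p.1.2, p.2.1.2, p.2.2.1.2, p.2.2.2.2))
      invFun := fun p => ((p.1.1, p.2.1), (p.1.2.1, p.2.2.1), (p.1.2.2.1, p.2.2.2.1),
        (p.1.2.2.2, p.2.2.2.2))
      left_inv := fun _ => rfl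
      right_inv := fun _ => rfl }
  have h := Fintype.sum_equiv e
    (fun p => realDeriv (realDeriv (realDeriv F p.1) p.2.1) p.2.2.1 p.2.2.2)
    (fun p => realDeriv (realDeriv (realDeriv F (p.1.1, p.2.1)) (p.1.2.1, p.2.2.1))
      (p.1.2.2.1, p.2.2.2.1) (p.1.2.2.2, p.2.2.2.2)) fun _ => rfl
  simp only [Fintype.sum_prod_type] at h
  simp only [cubeSum, Fintype.sum_prod_type]
  exact h

/-- The linear form in the frequencies which a cube of a bilinear phase gives rise to. -/
def cubeForm (f : V → ι → ZMod 2) (a b c x : V) :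
    (ι → ZMod 2) × (ι → ZMod 2) × (ι → ZMod 2) × (ι → ZMod 2) →+ ZMod 2 :=
  AddMonoidHom.mk' (fun w =>
      f (x + c + b + a) ⬝ᵥ (w.2.2.2 + w.2.2.1 + w.2.1 + w.1)
      + f (x + c + b) ⬝ᵥ (w.2.2.2 + w.2.2.1 + w.2.1)
      + (f (x + c + a) ⬝ᵥ (w.2.2.2 + w.2.2.1 + w.1) + f (x + c) ⬝ᵥ (w.2.2.2 + w.2.2.1))
      + (f (x + b + a) ⬝ᵥ (w.2.2.2 + w.2.1 + w.1) + f (x + b) ⬝ᵥ (w.2.2.2 + w.2.1)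
      + (f (x + a) ⬝ᵥ (w.2.2.2 + w.1) + f x ⬝ᵥ w.2.2.2)))
    fun w w' => by
      simp only [Prod.fst_add, Prod.snd_add, dotProduct_add]
      ring

lemma realDeriv_three_bilinear (f : V → ι → ZMod 2) (a b c x : V)
    (w : (ι → ZMod 2) × (ι → ZMod 2) × (ι → ZMod 2) × (ι → ZMod 2)) :
    realDeriv (realDeriv (realDeriv (fun v : V × (ι → ZMod 2) => sgn (f v.1 ⬝ᵥ v.2)) (a, w.1))
      (b, w.2.1)) (c, w.2.2.1) (x, w.2.2.2) = sgn (cubeForm f a b c x w) := by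
  simp only [realDeriv_three, cubeForm, AddMonoidHom.mk'_apply, sgn_add]
  rfl

/-- On such a cube `f` is affine in the cube coordinates, so its pairing with the affine frequency
variable has degree two and its third derivative vanishes. -/
lemma cubeForm_eq_zero (f : V → ι → ZMod 2) {T : Finset V}
    (hf : ∀ x a b, x ∈ T → x + a ∈ T → x + b ∈ T → x + a + b ∈ T →
      f x + f (x + a) + f (x + b) + f (x + a + b) = 0) {a b c x : V}
    (h0 : x ∈ T) (ha : x + a ∈ T) (hb : x + b ∈ T) (hc : x + c ∈ T) (hba : x + b + a ∈ T)
    (hca : x + c + a ∈ T) (hcb : x + c + b ∈ T) (hcba : x + c + b + a ∈ T) :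
    cubeForm f a b c x = 0 := by
  have e1 := add_eq_zero_iff_eq_of_two.1 (hf x b a h0 hb ha hba)
  have e2 := add_eq_zero_iff_eq_of_two.1 (hf x c a h0 hc ha hca)
  have e3 := add_eq_zero_iff_eq_of_two.1 (hf x c b h0 hc hb hcb)
  have e4 := add_eq_zero_iff_eq_of_two.1 (hf (x + c) b a hc hcb hca hcba)
  refine AddMonoidHom.ext fun w => ?_
  simp only [cubeForm, AddMonoidHom.mk'_apply, e4, e1, e2, e3, add_dotProduct, dotProduct_add,
    AddMonoidHom.zero_apply]
  grind

/-- For a fixed cube in `V`, the sum over frequencies is a full character sum, hence nonnegative,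
and it is maximal when the cube lies in `T`. No control of `f` off `T` is needed. -/
lemma card_pow_le_cubeSum_bilinear [Module (ZMod 2) V] [Fintype V] [DecidableEq ι] (f : V → ι → ZMod 2) {T : Finset V}
    (hf : ∀ x a b, x ∈ T → x + a ∈ T → x + b ∈ T → x + a + b ∈ T →
      f x + f (x + a) + f (x + b) + f (x + a + b) = 0) :
    ((T.card : ℝ) / Fintype.card V) ^ 8 * (Fintype.card (V × (ι → ZMod 2)) : ℝ) ^ 4
      ≤ cubeSum fun v : V × (ι → ZMod 2) => sgn (f v.1 ⬝ᵥ v.2) := by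
  classical
  have hV : (0 : ℝ) < Fintype.card V := by exact_mod_cast Fintype.card_pos
  let g : V → ℝ := fun x => if x ∈ T then 1 else 0
  have hg0 : ∀ x, x ∉ T → g x = 0 := fun x hx => if_neg hx
  have hg1 : ∀ x, x ∈ T → g x = 1 := fun x hx => if_pos hx
  have key : ∀ a b c x, (Fintype.card (ι → ZMod 2) : ℝ) ^ 4 * realDeriv (realDeriv (realDeriv g a) b) c x
      ≤ ∑ w, sgn (cubeForm f a b c x w) := by
    intro a b c x
    have hn := sum_sgn_nonneg (cubeForm f a b c x)
    rw [realDeriv_three]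
    by_cases h0 : x ∈ T
    swap; · simpa [hg0 _ h0] using hn
    by_cases ha : x + a ∈ T
    swap; · simpa [hg0 _ ha] using hn
    by_cases hb : x + b ∈ T
    swap; · simpa [hg0 _ hb] using hn
    by_cases hc : x + c ∈ T
    swap; · simpa [hg0 _ hc] using hn
    by_cases hba : x + b + a ∈ T
    swap; · simpa [hg0 _ hba] using hn
    by_cases hca : x + c + a ∈ T
    swap; · simpa [hg0 _ hca] using hn
    by_cases hcb : x + c + b ∈ T
    swap; · simpa [hg0 _ hcb] using hn
    by_cases hcba : x + c + b + a ∈ T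
    swap; · simpa [hg0 _ hcba] using hn
    rw [cubeForm_eq_zero f hf h0 ha hb hc hba hca hcb hcba, hg1 _ h0, hg1 _ ha, hg1 _ hb,
      hg1 _ hc, hg1 _ hba, hg1 _ hca, hg1 _ hcb, hg1 _ hcba]
    simp only [AddMonoidHom.zero_apply, sgn_zero, Finset.sum_const, Finset.card_univ,
      nsmul_eq_mul, Fintype.card_prod]
    push_cast
    apply le_of_eq
    ring
  have h1 : (Fintype.card (ι → ZMod 2) : ℝ) ^ 4 * cubeSum g
      ≤ cubeSum fun v : V × (ι → ZMod 2) => sgn (f v.1 ⬝ᵥ v.2) := by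
    rw [cubeSum_prod]
    simp only [realDeriv_three_bilinear, cubeSum, Finset.mul_sum]
    exact Finset.sum_le_sum fun a _ => Finset.sum_le_sum fun b _ => Finset.sum_le_sum fun c _ =>
      Finset.sum_le_sum fun x _ => key a b c x
  have h2 := sum_pow_eight_le_cubeSum g
  have h3 : ∑ x, g x = T.card := by simp [g]
  rw [h3] at h2
  refine le_trans ?_ h1
  rw [Fintype.card_prod, Nat.cast_mul, mul_pow, mul_comm ((Fintype.card V : ℝ) ^ 4), mul_left_comm,
    div_pow]
  refine mul_le_mul_of_nonneg_left ?_ (by positivity)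
  rw [div_mul_eq_mul_div, div_le_iff₀ (by positivity)]
  calc _ ≤ ((Fintype.card V : ℝ) ^ 4 * cubeSum g) * (Fintype.card V : ℝ) ^ 4 := by gcongr
    _ = _ := by ring

/-- Group the sum by fibres and apply Cauchy–Schwarz; the sum of squared fibre sizes is at most the
largest fibre times `|V|`. -/
lemma exists_large_fiber {V : Type*} [Fintype V] {Y : Type*} [Fintype Y] [DecidableEq Y] [Nonempty Y] (φ : V → Y)
    (w : Y → ℝ) :
    ∃ y, (∑ x, w (φ x)) ^ 2
      ≤ (Finset.card {x | φ x = y} : ℝ) * Fintype.card V * ∑ y, w y ^ 2 := by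
  obtain ⟨y, -, hy⟩ := Finset.exists_max_image Finset.univ
    (fun y => (Finset.card {x | φ x = y} : ℝ)) Finset.univ_nonempty
  refine ⟨y, ?_⟩
  have h1 : ∑ x, w (φ x) = ∑ y, (Finset.card {x | φ x = y} : ℝ) * w y := by
    rw [← Finset.sum_fiberwise Finset.univ φ]
    refine Finset.sum_congr rfl fun y _ => ?_
    rw [Finset.sum_congr rfl fun x hx => by rw [(Finset.mem_filter.1 hx).2], Finset.sum_const,
      nsmul_eq_mul]
  have h2 : ∑ y, (Finset.card {x | φ x = y} : ℝ) = Fintype.card V := by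
    have := Finset.card_eq_sum_card_fiberwise (f := φ) (s := Finset.univ) (t := Finset.univ)
      fun _ _ => Finset.mem_coe.2 (Finset.mem_univ _)
    rw [← Finset.card_univ, this, Nat.cast_sum]
  rw [h1]
  refine (Finset.sum_mul_sq_le_sq_mul_sq _ _ _).trans ?_
  refine mul_le_mul_of_nonneg_right ?_ (Finset.sum_nonneg fun _ _ => sq_nonneg _)
  rw [← h2, Finset.mul_sum]
  refine Finset.sum_le_sum fun z _ => ?_
  rw [sq]
  exact mul_le_mul_of_nonneg_right (hy z (Finset.mem_univ _)) (Nat.cast_nonneg _)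

/-- The mixed part of a quadratic function on a product is a bilinear form. -/
lemma IsQuadratic.exists_bilinear [Module (ZMod 2) V] [DecidableEq ι] {q : V × (ι → ZMod 2) → ZMod 2} (hq : IsQuadratic q) :
    ∃ B : V →ₗ[ZMod 2] (ι → ZMod 2), ∀ x z, q (x, z) = B x ⬝ᵥ z + q (x, 0) + q (0, z) + q 0 := by
  let β : V → (ι → ZMod 2) → ZMod 2 := fun x z => q (x, z) + q (x, 0) + q (0, z) + q 0
  have hl : ∀ x x' z, β (x + x') z = β x z + β x' z := fun x x' z => by
    have h1 := hq (x, 0) (x', 0) (0, z)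
    have h2 := hq (x, 0) (x', 0) 0
    simp only [Prod.mk_add_mk, add_zero, zero_add] at h1 h2
    simp only [β]
    grind
  have hr : ∀ x z z', β x (z + z') = β x z + β x z' := fun x z z' => by
    have h1 := hq (x, 0) (0, z) (0, z')
    have h2 := hq (0, z) (0, z') 0
    simp only [Prod.mk_add_mk, add_zero, zero_add] at h1 h2
    simp only [β]
    grind
  let B : V →+ (ι → ZMod 2) := AddMonoidHom.mk' (fun x i => β x (Pi.single i 1))
    fun x x' => by ext i; exact hl _ _ _
  refine ⟨B.toZModLinearMap 2, fun x z => ?_⟩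
  let b : (ι → ZMod 2) →ₗ[ZMod 2] ZMod 2 := (AddMonoidHom.mk' (β x) (hr x)).toZModLinearMap 2
  have h1 : B x ⬝ᵥ z = β x z := by
    have h2 : b z = _ := b.pi_apply_eq_sum_univ z
    have h3 : b z = β x z := rfl
    rw [← h3, h2, dotProduct]
    refine Finset.sum_congr rfl fun i _ => ?_
    rw [smul_eq_mul, mul_comm]
    congr 1
    change β x _ = β x _
    congr 1
    ext j
    simp [Pi.single_apply, eq_comm]
  change _ = B x ⬝ᵥ z + _ + _ + _
  rw [h1]
  simp only [β]
  grind

/-- Under the polynomial inverse Gowers conjecture, a function which respects the additive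
quadruples of a dense set agrees often with an affine map. -/
lemma PolynomialInverseGowersU3.exists_affine (h : PolynomialInverseGowersU3) :
    ∃ C : ℕ, 0 < C ∧ ∀ (V : Type) [AddCommGroup V] [Module (ZMod 2) V] [Fintype V]
      (ι : Type) [Fintype ι] [DecidableEq ι] (f : V → ι → ZMod 2) (T : Finset V), T.Nonempty →
      (∀ x a b, x ∈ T → x + a ∈ T → x + b ∈ T → x + a + b ∈ T →
        f x + f (x + a) + f (x + b) + f (x + a + b) = 0) →
      ∃ (B : V →ₗ[ZMod 2] (ι → ZMod 2)) (y : ι → ZMod 2),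
        4 * (((T.card : ℝ) / Fintype.card V) ^ C / C) ^ 2 * Fintype.card V
          ≤ (Finset.card {x | f x = B x + y} : ℝ) := by
  obtain ⟨C, hC, h⟩ := h.exists_isQuadratic
  refine ⟨C, hC, fun V _ _ _ ι _ _ f T hT hf => ?_⟩
  have hV : (0 : ℝ) < Fintype.card V := by exact_mod_cast Fintype.card_pos
  have hT0 : (0 : ℝ) < T.card := by exact_mod_cast hT.card_pos
  obtain ⟨q, hq, hsum⟩ := h (V × (ι → ZMod 2)) (fun v => f v.1 ⬝ᵥ v.2)
    ((T.card : ℝ) / Fintype.card V) (by positivity) (card_pow_le_cubeSum_bilinear f hf)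
  obtain ⟨B, hB⟩ := hq.exists_bilinear
  set δ : ℝ := ((T.card : ℝ) / Fintype.card V) ^ C / C with hδ
  have hδ0 : 0 ≤ δ := div_nonneg (pow_nonneg (div_pos hT0 hV).le _) (Nat.cast_nonneg _)
  let G : (ι → ZMod 2) → ℝ := fun z => sgn (q (0, z))
  let w : (ι → ZMod 2) → ℝ := fun y => |charTransform (dotPairing ι) G y|
  have hY : (0 : ℝ) < Fintype.card (ι → ZMod 2) := by exact_mod_cast Fintype.card_pos
  set N : ℝ := (Fintype.card (ι → ZMod 2) : ℝ) with hN
  have hG : ∀ z, G z ^ 2 = 1 := fun z => by rw [sq]; exact sgn_mul_self _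
  -- For fixed `x`, the sum over `z` is, up to sign, the Fourier coefficient of `G` at `f x + B x`.
  -- Parseval limits the frequencies with large coefficients, so `f + B` must repeat a value often.
  have h1 : ∑ v : V × (ι → ZMod 2), sgn (f v.1 ⬝ᵥ v.2 + q v) ≤ ∑ x, w (f x + B x) := by
    rw [Fintype.sum_prod_type]
    refine Finset.sum_le_sum fun x _ => ?_
    have : ∑ z, sgn (f x ⬝ᵥ z + q (x, z))
        = sgn (q (x, 0) + q 0) * charTransform (dotPairing ι) G (f x + B x) := by
      rw [charTransform, Finset.mul_sum]
      refine Finset.sum_congr rfl fun z _ => ?_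
      rw [hB, dotPairing_apply, dotProduct_comm z]
      simp only [G, add_dotProduct, sgn_add]
      ring
    rw [this]
    refine (le_abs_self _).trans ?_
    rw [abs_mul]
    refine mul_le_of_le_one_left (abs_nonneg _) ?_
    rcases zmod_two_cases (q (x, 0) + q 0) with h0 | h0 <;>
      rw [h0] <;> norm_num [sgn_zero, sgn_one]
  have h2 : ∑ y, w y ^ 2 = N ^ 2 := by
    simp only [w, sq_abs]
    rw [sum_charTransform_sq dotPairing_injective]
    rw [Finset.sum_congr rfl fun z _ => hG z, Finset.sum_const, Finset.card_univ, nsmul_eq_mul,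
      mul_one, sq]
  obtain ⟨y, hy⟩ := exists_large_fiber (fun x => f x + B x) w
  refine ⟨B, y, ?_⟩
  have h3 : (Finset.card {x | f x + B x = y} : ℝ) = (Finset.card {x | f x = B x + y} : ℝ) := by
    congr 2
    ext x
    simp only [Finset.mem_filter, Finset.mem_univ, true_and]
    constructor
    · rintro rfl
      rw [add_comm (f x), ← add_assoc, ZModModule.add_self, zero_add]
    · intro h
      rw [h, add_right_comm, ZModModule.add_self, zero_add]
  rw [h3, h2] at hy
  rw [Fintype.card_prod, Nat.cast_mul] at hsum
  have h4 := pow_le_pow_left₀ (mul_nonneg (mul_nonneg zero_le_two hδ0)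
    (mul_nonneg hV.le hY.le)) (hsum.trans h1) 2
  have h5 := h4.trans hy
  refine le_of_mul_le_mul_right ?_ (by positivity : 0 < (Fintype.card V : ℝ) * N ^ 2)
  refine le_trans (le_of_eq ?_) (h5.trans (le_of_eq ?_)) <;> ring

end BilinearPhase

/-! ### Inverse Gowers implies Freiman–Ruzsa -/

section Backward

lemma sq_le_two_pow_succ (k : ℕ) : k ^ 2 ≤ 2 ^ (k + 1) := by
  rcases lt_or_ge k 3 with h | h
  · interval_cases k <;> norm_num
  · induction k, h using Nat.le_induction with
    | base => norm_num
    | succ k hk ih =>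
      rw [pow_succ 2 (k + 1)]
      nlinarith

/-- An affine map can agree with linearly independent values on few points only. -/
lemma two_pow_card_le {V : Type*} [AddCommGroup V] [Module (ZMod 2) V] [Fintype V] {ι : Type*}
    (R : Finset V) (r : V → ι) (hr : Set.InjOn r R) (B : V →ₗ[ZMod 2] (ι → ZMod 2))
    (y : ι → ZMod 2) [DecidableEq ι]
    (hR : ∀ x ∈ R, ∀ z ∈ R, (B x + y) (r z) = (Pi.single (r x) 1 : ι → ZMod 2) (r z)) :
    2 ^ R.card ≤ 2 * Fintype.card V := by
  classical
  -- The extra factor `ZMod 2` makes the affine map linear. The points `(x, 1)` with `x ∈ R` hit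
  -- every basis vector, so `Ψ` is onto.
  let Ψ : V × ZMod 2 →ₗ[ZMod 2] (R → ZMod 2) :=
    (LinearMap.funLeft (ZMod 2) (ZMod 2) fun z : R => r z).comp
      (B.coprod (LinearMap.toSpanSingleton (ZMod 2) _ y))
  have hΨ : Function.Surjective Ψ := by
    rw [← LinearMap.range_eq_top, eq_top_iff, ← (Pi.basisFun (ZMod 2) R).span_eq,
      Submodule.span_le]
    rintro _ ⟨x, rfl⟩
    refine ⟨((x : V), 1), ?_⟩
    ext z
    have := hR x x.2 z z.2
    have e : (Ψ ((x : V), 1)) z = (B x + y) (r z) := by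
      simp [Ψ, LinearMap.funLeft_apply]
    rw [e, this, Pi.basisFun_apply, Pi.single_apply, Pi.single_apply]
    refine if_congr ?_ rfl rfl
    rw [hr.eq_iff z.2 x.2]
    exact Subtype.ext_iff.symm
  have := Fintype.card_le_of_surjective Ψ hΨ
  simpa [mul_comm] using this

variable {G : Type} [AddCommGroup G] [DecidableEq G]

lemma card_four_nsmul_le {S : Finset G} (hS : S.Nonempty) {K : ℝ}
    (hK : ((S + S).card : ℝ) ≤ K * S.card) : ((4 • S).card : ℝ) ≤ K ^ 4 * S.card := by
  have h0 : (0 : ℝ) < S.card := by exact_mod_cast hS.card_pos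
  have h := Finset.pluennecke_ruzsa_inequality_nsmul_add hS S 4
  have h' : ((4 • S).card : ℝ) ≤ (((S + S).card : ℝ) / S.card) ^ 4 * S.card := by
    have := (NNRat.cast_le (K := ℝ)).2 h
    push_cast at this
    exact this
  refine h'.trans ?_
  gcongr
  rwa [div_le_iff₀ h0]

variable [Module (ZMod 2) G] [Fintype G]

/-- A subspace of small index which meets the fourfold sumset of `S` trivially. -/
lemma exists_transverse_subspace {S : Finset G} (hS : S.Nonempty) :
    ∃ W : Submodule (ZMod 2) G,
      (∀ a ∈ S, ∀ b ∈ S, ∀ c ∈ S, ∀ d ∈ S, a + b + c + d ∈ W → a + b + c + d = 0) ∧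
      Nat.card (G ⧸ W) ≤ (4 • S).card := by
  have hmem : ∀ t : G, t ∈ 4 • S ↔ ∃ a ∈ S, ∃ b ∈ S, ∃ c ∈ S, ∃ d ∈ S, a + b + c + d = t := by
    intro t
    rw [show 4 • S = S + S + S + S by simp only [succ_nsmul, zero_nsmul, zero_add]]
    simp only [Finset.mem_add]
    constructor
    · rintro ⟨_, ⟨_, ⟨a, ha, b, hb, rfl⟩, c, hc, rfl⟩, d, hd, rfl⟩
      exact ⟨a, ha, b, hb, c, hc, d, hd, rfl⟩
    · rintro ⟨a, ha, b, hb, c, hc, d, hd, rfl⟩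
      exact ⟨_, ⟨_, ⟨a, ha, b, hb, rfl⟩, c, hc, rfl⟩, d, hd, rfl⟩
  have h0 : (0 : G) ∈ 4 • S := by
    obtain ⟨s, hs⟩ := hS
    refine (hmem 0).2 ⟨s, hs, s, hs, s, hs, s, hs, ?_⟩
    rw [ZModModule.add_self, zero_add, ZModModule.add_self]
  -- If some coset `v + W` missed `4 • S`, then `W` together with `v` would still be admissible. By
  -- maximality every coset is represented in `4 • S`, which bounds the index.
  obtain ⟨W, hW⟩ := (Set.toFinite {W : Submodule (ZMod 2) G | ∀ t ∈ 4 • S, t ∈ W → t = 0}).exists_maximal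
    ⟨⊥, fun t _ ht => (Submodule.mem_bot _).1 ht⟩
  refine ⟨W, fun a ha b hb c hc d hd h =>
    hW.prop _ ((hmem _).2 ⟨a, ha, b, hb, c, hc, d, hd, rfl⟩) h, ?_⟩
  have hsurj : Function.Surjective fun t : (4 • S : Finset G) => W.mkQ t := by
    intro x
    obtain ⟨v, rfl⟩ := W.mkQ_surjective x
    by_cases hv : v ∈ W
    · refine ⟨⟨0, h0⟩, ?_⟩
      simpa using ((Submodule.Quotient.mk_eq_zero W).2 hv).symm
    · by_contra hc
      have hlt : W ≤ W ⊔ Submodule.span (ZMod 2) {v} := le_sup_left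
      refine hv (hW.le_of_ge (y := W ⊔ Submodule.span (ZMod 2) {v}) (fun t ht htW => ?_) hlt
        (le_sup_right (a := W) (Submodule.mem_span_singleton_self v)))
      obtain ⟨w, hw, u, hu, rfl⟩ := Submodule.mem_sup.1 htW
      obtain ⟨k, rfl⟩ := Submodule.mem_span_singleton.1 hu
      rcases zmod_two_cases k with rfl | rfl
      · rw [zero_smul, add_zero] at ht ⊢
        exact hW.prop w ht hw
      · refine absurd ⟨⟨w + (1 : ZMod 2) • v, ht⟩, ?_⟩ hc
        simp [hw]
  have := Nat.card_le_card_of_surjective _ hsurj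
  simpa using this

/-- A set of small doubling is Freiman isomorphic to a dense subset of a finite space. -/
lemma exists_dense_model {S : Finset G} (hS : S.Nonempty) {K : ℝ}
    (hK : ((S + S).card : ℝ) ≤ K * S.card) :
    ∃ (V : Type) (_ : AddCommGroup V) (_ : Module (ZMod 2) V) (_ : Fintype V) (T : Finset V)
      (s : V → G), T.card = S.card ∧ (Fintype.card V : ℝ) ≤ K ^ 4 * S.card ∧
      (∀ x ∈ T, s x ∈ S) ∧ Set.InjOn s T ∧
      ∀ x a b, x ∈ T → x + a ∈ T → x + b ∈ T → x + a + b ∈ T →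
        s x + s (x + a) + s (x + b) + s (x + a + b) = 0 := by
  classical
  obtain ⟨W, hW, hWcard⟩ := exists_transverse_subspace hS
  let _ : Fintype (G ⧸ W) := Fintype.ofFinite _
  have hinj : Set.InjOn W.mkQ S := by
    intro a ha b hb hab
    have h1 : a + b ∈ W := by
      rw [← ZModModule.sub_eq_add]
      exact (Submodule.Quotient.eq W).1 hab
    -- Padding by `a + a = 0` turns the pair into a sum of four elements of `S`.
    have h2 := hW a ha b hb a ha a ha (by rwa [add_assoc, ZModModule.add_self, add_zero])
    rw [add_assoc, ZModModule.add_self, add_zero] at h2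
    exact (add_eq_zero_iff_eq_of_two.1 h2).symm
  have hex : ∀ x ∈ S.image W.mkQ, ∃ a ∈ S, W.mkQ a = x := fun x hx => Finset.mem_image.1 hx
  choose! s hsS hs using hex
  refine ⟨G ⧸ W, inferInstance, inferInstance, inferInstance, S.image W.mkQ, s,
    Finset.card_image_of_injOn hinj, ?_, hsS, ?_, ?_⟩
  · refine le_trans ?_ (card_four_nsmul_le hS hK)
    rw [← Nat.card_eq_fintype_card]
    exact_mod_cast hWcard
  · intro v hv w hw hvw
    rw [← hs v hv, ← hs w hw, hvw]
  · intro x a b h0 ha hb hab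
    refine hW _ (hsS _ h0) _ (hsS _ ha) _ (hsS _ hb) _ (hsS _ hab) ?_
    rw [← Submodule.Quotient.mk_eq_zero, ← Submodule.mkQ_apply, map_add, map_add, map_add,
      hs _ h0, hs _ ha, hs _ hb, hs _ hab]
    have : x + (x + a) + (x + b) + (x + a + b) = ((x + a) + (x + a)) + ((x + b) + (x + b)) := by
      abel
    rw [this, ZModModule.add_self, ZModModule.add_self, add_zero]

/-- The affine image lies in the range of the linear map `(v, c) ↦ B v + c y`, whose source has `2
|V|` elements. -/
lemma card_affine_span_le {V Y : Type*} [AddCommGroup V] [Module (ZMod 2) V] [Fintype V]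
    [AddCommGroup Y] [Module (ZMod 2) Y] (B : V →ₗ[ZMod 2] Y) (y : Y) {s : Set Y}
    (hs : ∀ x ∈ s, ∃ v, x = B v + y) :
    Nat.card (Submodule.span (ZMod 2) s) ≤ 2 * Fintype.card V := by
  let Φ : V × ZMod 2 →ₗ[ZMod 2] Y := B.coprod (LinearMap.toSpanSingleton (ZMod 2) _ y)
  have hle : Submodule.span (ZMod 2) s ≤ LinearMap.range Φ := by
    rw [Submodule.span_le]
    intro x hx
    obtain ⟨v, rfl⟩ := hs x hx
    exact ⟨(v, 1), by simp [Φ]⟩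
  have : Finite (LinearMap.range Φ) := Finite.of_surjective _ Φ.surjective_rangeRestrict
  have h1 : Nat.card (Submodule.span (ZMod 2) s) ≤ Nat.card (LinearMap.range Φ) :=
    Nat.card_le_card_of_injective _ (Submodule.inclusion_injective hle)
  have h2 := Nat.card_le_card_of_surjective _ Φ.surjective_rangeRestrict
  refine h1.trans (h2.trans (le_of_eq ?_))
  simp [mul_comm]

/-- An affine map which agrees often with the inverse of a dense model yields
a large subset of small span. -/
lemma exists_subset_of_affine {n C : ℕ} (hC : 0 < C) {S : Finset (F2 n)} (hS : S.Nonempty) {K : ℝ}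
    (hK1 : 1 ≤ K) {V : Type} [AddCommGroup V] [Module (ZMod 2) V] [Fintype V] [DecidableEq V]
    {T : Finset V} {s : V → F2 n} (hTcard : T.card = S.card)
    (hVle : (Fintype.card V : ℝ) ≤ K ^ 4 * S.card) (hsS : ∀ x ∈ T, s x ∈ S)
    (hsinj : Set.InjOn s T) {f : V → (Fin n ⊕ V) → ZMod 2}
    (hfT : ∀ x ∈ T, f x = Sum.elim (s x) 0)
    (hfT' : ∀ x, x ∉ T → f x = (Sum.elim 0 (Pi.single x 1) : Fin n ⊕ V → ZMod 2))
    {B : V →ₗ[ZMod 2] (Fin n ⊕ V → ZMod 2)} {y : Fin n ⊕ V → ZMod 2}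
    (hB : 4 * (((T.card : ℝ) / Fintype.card V) ^ C / C) ^ 2 * Fintype.card V
      ≤ (Finset.card {x | f x = B x + y} : ℝ)) :
    ∃ S' : Finset (F2 n), S' ⊆ S ∧
      (S.card : ℝ) / ((C ^ 4 + 16 * C : ℕ) * K ^ (C ^ 4 + 16 * C)) ≤ (S'.card : ℝ) ∧
      (Nat.card (Submodule.span (ZMod 2) (S' : Set (F2 n))) : ℝ)
        ≤ (C ^ 4 + 16 * C : ℕ) * K ^ (C ^ 4 + 16 * C) * (S.card : ℝ) := by
  have hCr : (1 : ℝ) ≤ C := by exact_mod_cast hC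
  have hS0 : (0 : ℝ) < S.card := by exact_mod_cast hS.card_pos
  have hS1 : (1 : ℝ) ≤ S.card := by exact_mod_cast hS.card_pos
  obtain ⟨D, hD⟩ : ∃ D : ℕ, D = C ^ 4 + 16 * C := ⟨_, rfl⟩
  rw [← hD]
  have hDC : (C : ℝ) ^ 4 ≤ D := by
    rw [hD]; push_cast; linarith
  have hD2 : (2 : ℝ) ≤ D := by
    rw [hD]; push_cast; nlinarith [pow_nonneg (zero_le_one.trans hCr) 4]
  have hKD : ∀ k, k ≤ 16 * C → K ^ k ≤ K ^ D := fun k hk =>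
    pow_le_pow_right₀ hK1 (by omega)
  have hKD0 : (0 : ℝ) < D * K ^ D := by positivity
  have hVS : (S.card : ℝ) ≤ Fintype.card V := by
    rw [← hTcard]
    exact_mod_cast Finset.card_le_univ T
  rw [hTcard] at hB
  set Q := Finset.univ.filter fun x => f x = B x + y with hQ
  set Q₁ := Q.filter (· ∈ T) with hQ₁
  set R := Q.filter (¬ · ∈ T) with hR
  have hsplit : (Q.card : ℝ) = Q₁.card + R.card := by
    exact_mod_cast (Finset.card_filter_add_card_filter_not (s := Q) (· ∈ T)).symm
  set P : ℝ := C * K ^ (4 * C) with hP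
  have hP0 : 0 < P := by positivity
  have hV0 : (0 : ℝ) < Fintype.card V := hS0.trans_le hVS
  -- The model has density at least `K⁻⁴`.
  have hδ : 1 / P ≤ ((S.card : ℝ) / Fintype.card V) ^ C / C := by
    rw [hP, mul_comm, ← div_div, pow_mul, ← one_div_pow]
    have : 1 / K ^ 4 ≤ (S.card : ℝ) / Fintype.card V := by
      rw [div_le_div_iff₀ (by positivity) hV0]
      linarith
    gcongr
  have hcount : 4 * Fintype.card V ≤ (Q₁.card + R.card) * P ^ 2 := by
    rw [← hsplit]
    have : 4 * (1 / P) ^ 2 * Fintype.card V ≤ Q.card := le_trans (by gcongr) hB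
    rw [one_div_pow, mul_one_div, div_mul_eq_mul_div, div_le_iff₀ (by positivity)] at this
    exact this
  have hQ₁mem : ∀ x ∈ Q₁, x ∈ T ∧ f x = B x + y := fun x hx => by
    rw [hQ₁, Finset.mem_filter, hQ, Finset.mem_filter] at hx
    exact ⟨hx.2, hx.1.2⟩
  have hRmem : ∀ x ∈ R, x ∉ T ∧ f x = B x + y := fun x hx => by
    rw [hR, Finset.mem_filter, hQ, Finset.mem_filter] at hx
    exact ⟨hx.2, hx.1.2⟩
  -- Of the agreement set, either the part in `T` or the part outside accounts for half of the bound
  -- `4 |V|`. In the first case that part lifts to a large subset of `S` in an affine image of `V`.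
  by_cases hcase : 2 * (Fintype.card V : ℝ) ≤ Q₁.card * P ^ 2
  · refine ⟨Q₁.image s, ?_, ?_, ?_⟩
    · intro x hx
      obtain ⟨v, hv, rfl⟩ := Finset.mem_image.1 hx
      exact hsS v (hQ₁mem v hv).1
    · rw [Finset.card_image_of_injOn, div_le_iff₀ hKD0]
      · have hPD : P ^ 2 ≤ D * K ^ D := by
          calc P ^ 2 = (C : ℝ) ^ 2 * K ^ (8 * C) := by rw [hP]; ring
            _ ≤ D * K ^ D := by
              refine mul_le_mul (le_trans ?_ hDC) (hKD _ (by omega)) (by positivity)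
                (Nat.cast_nonneg _)
              exact pow_le_pow_right₀ hCr (by norm_num)
        calc (S.card : ℝ) ≤ Q₁.card * P ^ 2 := by linarith
          _ ≤ _ := mul_le_mul_of_nonneg_left hPD (Nat.cast_nonneg _)
      · intro v hv w hw hvw
        exact hsinj (hQ₁mem v hv).1 (hQ₁mem w hw).1 hvw
    · have hspan := card_affine_span_le
        ((LinearMap.funLeft (ZMod 2) (ZMod 2) (Sum.inl : Fin n → Fin n ⊕ V)).comp B)
        (fun i => y (Sum.inl i)) (s := ((Q₁.image s : Finset (F2 n)) : Set (F2 n))) (by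
          intro x hx
          obtain ⟨v, hv, rfl⟩ := Finset.mem_image.1 (Finset.mem_coe.1 hx)
          refine ⟨v, funext fun i => ?_⟩
          have h1 := congrFun (hQ₁mem v hv).2 (Sum.inl i)
          rw [hfT v (hQ₁mem v hv).1] at h1
          exact h1)
      calc _ ≤ 2 * (Fintype.card V : ℝ) := by exact_mod_cast hspan
        _ ≤ 2 * (K ^ 4 * S.card) := mul_le_mul_of_nonneg_left hVle zero_le_two
        _ ≤ D * (K ^ D * S.card) :=
          mul_le_mul hD2 (mul_le_mul_of_nonneg_right (hKD 4 (by omega)) hS0.le)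
            (mul_nonneg (pow_nonneg (zero_le_one.trans hK1) 4) hS0.le) (Nat.cast_nonneg _)
        _ = _ := by ring
  · have hR2 : 2 * (Fintype.card V : ℝ) < R.card * P ^ 2 := by
      rw [not_le] at hcase
      linarith
    have hRcard := two_pow_card_le R (Sum.inr : V → Fin n ⊕ V) Sum.inr_injective.injOn B y (by
      intro x hx z _
      rw [← (hRmem x hx).2]
      simp only [hfT' x (hRmem x hx).1, Sum.elim_inr, Pi.single_apply, Sum.inr.injEq])
    have hRsq : (R.card : ℝ) ^ 2 ≤ 4 * Fintype.card V := by
      have := sq_le_two_pow_succ R.card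
      rw [pow_succ 2] at this
      have h2 : R.card ^ 2 ≤ 4 * Fintype.card V := by omega
      exact_mod_cast h2
    -- Agreement off `T` satisfies both `|R|² ≤ 4 |V|` and `|R| P² > 2 |V|`, which forces `V` to be
    -- bounded; a single point of `S` is then a large enough subset.
    have hVP : (Fintype.card V : ℝ) ≤ P ^ 4 := by
      have h1 : (2 * (Fintype.card V : ℝ)) ^ 2 ≤ (R.card * P ^ 2) ^ 2 :=
        pow_le_pow_left₀ (mul_nonneg zero_le_two hV0.le) hR2.le 2
      have h2 : ((R.card : ℝ) * P ^ 2) ^ 2 ≤ 4 * Fintype.card V * P ^ 4 := by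
        calc _ = (R.card : ℝ) ^ 2 * P ^ 4 := by ring
          _ ≤ _ := mul_le_mul_of_nonneg_right hRsq (pow_nonneg hP0.le 4)
      refine le_of_mul_le_mul_left ?_ (mul_pos zero_lt_four hV0)
      refine le_trans (le_of_eq ?_) (h1.trans h2)
      ring
    obtain ⟨a, ha⟩ := hS
    refine ⟨{a}, Finset.singleton_subset_iff.2 ha, ?_, ?_⟩
    · rw [Finset.card_singleton, Nat.cast_one, div_le_one hKD0]
      calc (S.card : ℝ) ≤ P ^ 4 := hVS.trans hVP
        _ = (C : ℝ) ^ 4 * K ^ (16 * C) := by rw [hP]; ring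
        _ ≤ _ := by
          gcongr
          omega
    · have hspan := card_affine_span_le (0 : F2 0 →ₗ[ZMod 2] F2 n) a
        (s := (({a} : Finset (F2 n)) : Set (F2 n))) (by
          intro x hx
          exact ⟨0, by simpa using hx⟩)
      calc _ ≤ (2 : ℝ) := by exact_mod_cast hspan
        _ = 2 * 1 * 1 := by norm_num
        _ ≤ D * K ^ D * S.card := mul_le_mul (mul_le_mul hD2 (one_le_pow₀ hK1) zero_le_one
            (Nat.cast_nonneg _)) hS1 zero_le_one hKD0.le

/-- The polynomial inverse Gowers conjecture implies the polynomial Freiman–Ruzsa conjecture. -/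
theorem PolynomialInverseGowersU3.polynomialFreimanRuzsa (h : PolynomialInverseGowersU3) :
    PolynomialFreimanRuzsa := by
  classical
  obtain ⟨C, hC, h⟩ := h.exists_affine
  refine ⟨C ^ 4 + 16 * C, by positivity, fun n S K hS hK => ?_⟩
  have hK1 : 1 ≤ K := by
    have h1 : (S.card : ℝ) ≤ (S + S).card := by exact_mod_cast Finset.card_le_card_add_right hS
    exact le_of_mul_le_mul_right (by linarith : 1 * (S.card : ℝ) ≤ K * S.card)
      (by exact_mod_cast hS.card_pos)
  obtain ⟨V, _, _, _, T, s, hTcard, hVle, hsS, hsinj, hquad⟩ := exists_dense_model hS hK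
  have hT : T.Nonempty := by
    rw [← Finset.card_pos, hTcard]
    exact hS.card_pos
  -- The coordinates indexed by `V` vanish on `T`, so additive quadruples there are unaffected; off
  -- `T` they carry independent basis vectors, which an affine map can match only rarely.
  let f : V → (Fin n ⊕ V) → ZMod 2 := fun x =>
    if x ∈ T then Sum.elim (s x) 0 else Sum.elim 0 (Pi.single x 1)
  have hfT : ∀ x ∈ T, f x = Sum.elim (s x) 0 := fun x hx => if_pos hx
  obtain ⟨B, y, hB⟩ := h V (Fin n ⊕ V) f T hT (by
    intro x a b h0 ha hb hab
    rw [hfT _ h0, hfT _ ha, hfT _ hb, hfT _ hab]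
    funext i
    rcases i with i | i
    · exact congrFun (hquad x a b h0 ha hb hab) i
    · simp)
  exact exists_subset_of_affine hC hS hK1 hTcard hVle hsS hsinj hfT (fun x hx => if_neg hx) hB

end Backward

theorem mainTheorem1 : PolynomialFreimanRuzsa ↔ PolynomialInverseGowersU3 :=
  ⟨PolynomialFreimanRuzsa.polynomialInverseGowersU3,
    PolynomialInverseGowersU3.polynomialFreimanRuzsa⟩
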